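/- Let $\mathcal C$ be a triangulated category with Grothendieck group $K(\mathcal C)$. A stability condition $\sigma=(Z_\sigma,P_\sigma)$ on $\mathcal C$ consists of a homomorphism $Z_\sigma:K(\mathcal C)\to\mathbb C$ and full additive, isomorphism-closed subcategories $P_\sigma(\varphi)\subset\mathcal C$, $\varphi\in\mathbb R$, such that: (i) if $0\neq c\in P_\sigma(\varphi)$ then $Z_\sigma(c)=m\,e^{i\pi\varphi}$ for some $m>0$; (ii) $P_\sigma(\varphi+1)=P_\sigma(\varphi)[1]$; (iii) $\mathrm{Hom}(c,c')=0$ if $c\in P_\sigma(\varphi)$, $c'\in P_\sigma(\varphi')$ and $\varphi>\varphi'$; (iv) every $c\neq0$ has a Harder–Narasimhan filtration, i.e. a finite chain $0=c_0\to c_1\to\cdots\to c_n=c$ in which the cone $b_j$ of $c_{j-1}\to c_j$ is a nonzero object of $P_\sigma(\varphi_j)$, with $\varphi_1>\dots>\varphi_n$. This filtration is unique up to isomorphism; put $\varphi^+_\sigma(c)=\varphi_1$, $\varphi^-_\sigma(c)=\varphi_n$ and $m_\sigma(c)=\sum_j|Z_\sigma(b_j)|$. The nonzero objects of $P_\sigma(\varphi)$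 are the semistable objects of phase $\varphi$. For an interval $I\subset\mathbb R$ let $P_\sigma(I)$ be the extension-closed subcategory generated by the $P_\sigma(\varphi)$, $\varphi\in I$; when $I$ has length less than $1$ it is quasi-abelian, its strict short exact sequences being the exact triangles $a\to b\to c\to a[1]$ with $a,b,c\in P_\sigma(I)$. Let $\mathrm{Stab}(\mathcal C)$ be the set of stability conditions that are locally finite: for each $t\in\mathbb R$ there is $\epsilon\in(0,\tfrac12)$ such that $P_\sigma(t-\epsilon,t+\epsilon)$ is artinian and noetherian (with respect to strict subobjects). It carries the generalised metric $$d(\sigma,\tau)=\sup_{0\neq c\in\mathcal C}\max\left\{|\varphi_\sigma^-(c)-\varphi_\tau^-(c)|,\ |\varphi_\sigma^+(c)-\varphi_\tau^+(c)|,\ \left|\log\frac{m_\sigma(c)}{m_\tau(c)}\right|\right\}\in[0,\infty].$$ Let $G$ be the universal cover of $GL_2^+\mathbb R$, i.e. the group of pairs $g=(T_g,\theta_g)$ with $T_g\in GL_2^+\mathbb R$ and $\theta_g:\mathbb R\to\mathbb R$ an increasing bijection with $\theta_g(t+1)=\theta_g(t)+1$ which induces the same map as $T_g$ on the circle $\mathbb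 R/2\mathbb Z=(\mathbb R^2-\{0\})/\mathbb R_{>0}$, where $t$ corresponds to the ray through $e^{i\pi t}\in\mathbb C=\mathbb R^2$. It acts on the right of $\mathrm{Stab}(\mathcal C)$ by $(Z,P)\cdot g=(T_g^{-1}\circ Z,\ P\circ\theta_g)$. The group $\mathbb C$ is embedded in $G$ by sending $\lambda$ to the pair consisting of multiplication by $e^{i\pi\lambda}$ and the translation $t\mapsto t+\mathrm{Re}\,\lambda$. For $g\in G$ let $$\Delta(g)=\max\left\{\sup_{t\in\mathbb R}|\theta_g(t)-t|,\ \log\|T_g\|,\ \log\|T_g^{-1}\|\right\},$$ where $\|T\|$ is the operator norm for the Euclidean norm on $\mathbb R^2$. **Proposition.** Let $\sigma\in\mathrm{Stab}(\mathcal C)$ be such that the set of phases of $\sigma$-semistable objects is dense in $\mathbb R$. Then: 1. The $G$-orbit through $\sigma$ is free: if $\tau\in\sigma G$, $g\in G$ and $\tau g=\tau$, then $g=1$. 2. $d_G(g,h):=\Delta(h^{-1}g)$ is a metric on $G$ (which does not depend on $\sigma$ or on $\mathcal C$), and $d(\sigma g,\sigma h)=d_G(g,h)$ for all $g,h\in G$.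 It is left-invariant, $d_G(fg,fh)=d_G(g,h)$, and complete. 3. The map $\sigma g\mapsto T_g\cdot i$, where $\begin{pmatrix}a&b\\c&d\end{pmatrix}\cdot i=\frac{ai+b}{ci+d}$, is well defined and induces a bijection from $\sigma G/\mathbb C$ to the upper half-plane $\mathbb H$. Under it the quotient metric $\overline d(x\mathbb C,y\mathbb C)=\inf_{\lambda\in\mathbb C}d(x,y\lambda)$ on $\sigma G/\mathbb C$ becomes $\frac12d_{\mathrm{hyp}}$, where $d_{\mathrm{hyp}}$ is the hyperbolic metric on $\mathbb H$ of curvature $-1$. -/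

import Mathlib

open CategoryTheory CategoryTheory.Limits CategoryTheory.Pretriangulated
open scoped MatrixGroups UpperHalfPlane ENNReal RightActions

universe v u

namespace Stability

section Triangulated

variable {C : Type u} [Category.{v} C] [Preadditive C] [HasZeroObject C]
  [HasShift C ℤ] [∀ n : ℤ, (shiftFunctor C n).Additive] [Pretriangulated C]

variable (C) in
/-- The relations `[b] = [a] + [c]`, one for each exact triangle `a ⟶ b ⟶ c ⟶ a[1]`. -/
def triangleRelations : AddSubgroup (FreeAbelianGroup C) :=
  AddSubgroup.closure {x | ∃ T ∈ distTriang C,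
    x = FreeAbelianGroup.of T.obj₂ - FreeAbelianGroup.of T.obj₁ - FreeAbelianGroup.of T.obj₃}

variable (C) in
/-- The Grothendieck group of a triangulated category. -/
abbrev K₀ : Type u := FreeAbelianGroup C ⧸ triangleRelations C

/-- The class of an object in the Grothendieck group. -/
def K₀.cls (c : C) : K₀ C := QuotientAddGroup.mk (FreeAbelianGroup.of c)

/-- Harder-Narasimhan filtrations of `c` with respect to the subcategories `P φ`: a finite chain
`0 = c_0 ⟶ c_1 ⟶ ⋯ ⟶ c_n ≅ c` such that the cone of each map `c_j ⟶ c_(j+1)` is a nonzero object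
of `P (φ_j)`, with strictly decreasing phases. The number of factors is `len + 1`; so it is
at least one, as it has to be for a nonzero object. -/
structure HNFiltration (P : ℝ → ObjectProperty C) (c : C) where
  len : ℕ
  obj : Fin (len + 2) → C
  factor : Fin (len + 1) → C
  phase : Fin (len + 1) → ℝ
  isZero_zero : IsZero (obj 0)
  last_iso : Nonempty (obj (Fin.last (len + 1)) ≅ c)
  triangle : ∀ j : Fin (len + 1), ∃ (f : obj j.castSucc ⟶ obj j.succ) (g : obj j.succ ⟶ factor j)
    (h : factor j ⟶ (obj j.castSucc)⟦(1 : ℤ)⟧), Triangle.mk f g h ∈ distTriang C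
  factor_nonzero : ∀ j, ¬ IsZero (factor j)
  factor_mem : ∀ j, P (phase j) (factor j)
  phase_anti : StrictAnti phase

variable (C) in
/-- Stability conditions on a triangulated category: a central charge `Z` and a family of full
additive subcategories `P φ` (closed under isomorphism), where `φ` is a real number. -/
@[ext]
structure StabilityCondition where
  Z : K₀ C →+ ℂ
  P : ℝ → ObjectProperty C
  mem_of_iso : ∀ (φ : ℝ) {a b : C}, (a ≅ b) → P φ a → P φ b
  mem_of_isZero : ∀ (φ : ℝ) {a : C}, IsZero a → P φ a
  mem_biprod : ∀ (φ : ℝ) {a b : C} (t : BinaryBicone a b), Nonempty t.IsBilimit →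
    P φ a → P φ b → P φ t.pt
  charge : ∀ (φ : ℝ) (c : C), P φ c → ¬ IsZero c → ∃ m : ℝ, 0 < m ∧
    Z (K₀.cls c) = m * Complex.exp (Complex.I * Real.pi * φ)
  shift : ∀ (φ : ℝ) (c : C), P (φ + 1) (c⟦(1 : ℤ)⟧) ↔ P φ c
  hom_eq_zero : ∀ (φ ψ : ℝ) (a b : C), ψ < φ → P φ a → P ψ b → ∀ f : a ⟶ b, f = 0
  exists_HN : ∀ c : C, ¬ IsZero c → Nonempty (HNFiltration P c)

/-- The ext-closed subcategory generated by a class of objects. -/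
inductive ExtClosure (S : ObjectProperty C) : C → Prop
  | zero {c : C} (hc : IsZero c) : ExtClosure S c
  | of {b c : C} (hb : S b) (e : b ≅ c) : ExtClosure S c
  | ext (T : Triangle C) (hT : T ∈ distTriang C) (h₁ : ExtClosure S T.obj₁)
      (h₃ : ExtClosure S T.obj₃) : ExtClosure S T.obj₂

/-- A morphism `i : a ⟶ b` between objects of `Q` is strict mono if it fits in an exact triangle
`a ⟶ b ⟶ c ⟶ a[1]` with `c` in `Q`. When `Q` is the quasi-abelian category `P(I)` of a stability
condition, for an interval `I` of length less than one, these are the strict monomorphisms. -/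
def IsStrictMono (Q : ObjectProperty C) {a b : C} (i : a ⟶ b) : Prop :=
  ∃ (c : C) (p : b ⟶ c) (δ : c ⟶ a⟦(1 : ℤ)⟧), Q c ∧ Triangle.mk i p δ ∈ distTriang C

/-- Every ascending chain of strict subobjects of an object of `Q` stabilises. -/
def IsNoetherianStrict (Q : ObjectProperty C) : Prop :=
  ∀ (b : C) (a : ℕ → C) (i : ∀ n, a n ⟶ b) (f : ∀ n, a n ⟶ a (n + 1)), Q b → (∀ n, Q (a n)) →
    (∀ n, IsStrictMono Q (i n)) → (∀ n, f n ≫ i (n + 1) = i n) → ∃ N, ∀ n, N ≤ n → IsIso (f n)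

/-- Every descending chain of strict subobjects of an object of `Q` stabilises. -/
def IsArtinianStrict (Q : ObjectProperty C) : Prop :=
  ∀ (b : C) (a : ℕ → C) (i : ∀ n, a n ⟶ b) (f : ∀ n, a (n + 1) ⟶ a n), Q b → (∀ n, Q (a n)) →
    (∀ n, IsStrictMono Q (i n)) → (∀ n, f n ≫ i n = i (n + 1)) → ∃ N, ∀ n, N ≤ n → IsIso (f n)

theorem ExtClosure.mono {S S' : ObjectProperty C} (h : ∀ c, S c → S' c) {c : C}
    (hc : ExtClosure S c) : ExtClosure S' c := by
  induction hc with
  | zero hc => exact .zero hc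
  | of hb e => exact .of (h _ hb) e
  | ext T hT _ _ h₁ h₃ => exact .ext T hT h₁ h₃

theorem IsStrictMono.mono {Q Q' : ObjectProperty C} (h : ∀ c, Q c → Q' c) {a b : C} {i : a ⟶ b}
    (hi : IsStrictMono Q i) : IsStrictMono Q' i := by
  obtain ⟨c, p, δ, hc, hT⟩ := hi
  exact ⟨c, p, δ, h c hc, hT⟩

theorem IsNoetherianStrict.anti {Q Q' : ObjectProperty C} (h : ∀ c, Q c → Q' c)
    (hQ : IsNoetherianStrict Q') : IsNoetherianStrict Q :=
  fun b a i f hb ha hi hf => hQ b a i f (h b hb) (fun n => h _ (ha n)) (fun n => (hi n).mono h) hf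

theorem IsArtinianStrict.anti {Q Q' : ObjectProperty C} (h : ∀ c, Q c → Q' c)
    (hQ : IsArtinianStrict Q') : IsArtinianStrict Q :=
  fun b a i f hb ha hi hf => hQ b a i f (h b hb) (fun n => h _ (ha n)) (fun n => (hi n).mono h) hf

namespace StabilityCondition

variable (σ : StabilityCondition C)

/-- The full subcategory `P(I)` generated under extensions by the semistable objects with phases
in `I`. -/
def PI (I : Set ℝ) : ObjectProperty C := ExtClosure fun c => ∃ φ ∈ I, σ.P φ c

/-- Local finiteness: around every `t` there is an open interval of length less than one whose
quasi-abelian category is both artinian and noetherian. -/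
def LocallyFinite : Prop :=
  ∀ t : ℝ, ∃ ε : ℝ, 0 < ε ∧ ε < 1 / 2 ∧ IsNoetherianStrict (σ.PI (Set.Ioo (t - ε) (t + ε))) ∧
    IsArtinianStrict (σ.PI (Set.Ioo (t - ε) (t + ε)))

/-- The phases of the (nonzero) semistable objects. -/
def phases : Set ℝ := {φ | ∃ c : C, ¬ IsZero c ∧ σ.P φ c}

/-- A Harder-Narasimhan filtration of a nonzero object. It is unique up to isomorphism, so that
the choice is immaterial below. -/
noncomputable def hn (c : {c : C // ¬ IsZero c}) : HNFiltration σ.P c.1 :=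
  Classical.choice (σ.exists_HN c.1 c.2)

/-- The largest phase of a Harder-Narasimhan factor. -/
noncomputable def phaseMax (c : {c : C // ¬ IsZero c}) : ℝ := (σ.hn c).phase 0

/-- The smallest phase of a Harder-Narasimhan factor. -/
noncomputable def phaseMin (c : {c : C // ¬ IsZero c}) : ℝ :=
  (σ.hn c).phase (Fin.last (σ.hn c).len)

/-- The mass of an object. A semistable object `b` has `Z(b) = m(b) exp(iπφ)` with `m(b) > 0`,
so that `m(b) = |Z(b)|`. -/
noncomputable def mass (c : {c : C // ¬ IsZero c}) : ℝ :=
  ∑ j, ‖σ.Z (K₀.cls ((σ.hn c).factor j))‖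

end StabilityCondition

end Triangulated

/-- The real-linear endomorphism of `ℂ = ℝ²` given by a matrix. -/
noncomputable def planeMap (T : GL (Fin 2) ℝ) : ℂ →ₗ[ℝ] ℂ :=
  Matrix.toLin Complex.basisOneI Complex.basisOneI T.1

theorem planeMap_one : planeMap 1 = LinearMap.id := by
  simp [planeMap]

theorem planeMap_mul (S T : GL (Fin 2) ℝ) : planeMap (S * T) = planeMap S ∘ₗ planeMap T := by
  simp [planeMap, Matrix.toLin_mul Complex.basisOneI Complex.basisOneI Complex.basisOneI]

theorem planeMap_inv_apply (T : GL (Fin 2) ℝ) (z : ℂ) : planeMap T⁻¹ (planeMap T z) = z := by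
  rw [← LinearMap.comp_apply, ← planeMap_mul, inv_mul_cancel, planeMap_one, LinearMap.id_apply]

/-- The operator norm of a matrix with respect to the Euclidean norm on `ℝ²`. -/
noncomputable def opNorm (T : GL (Fin 2) ℝ) : ℝ := ‖LinearMap.toContinuousLinearMap (planeMap T)‖

/-- The unit vector of phase `t`. -/
noncomputable def ray (t : ℝ) : ℂ := Complex.exp (Complex.I * Real.pi * t)

/-- The universal cover of `GL₂⁺(ℝ)` in its standard model: the group of pairs `(T, θ)` of a matrix
`T` of positive determinant and an increasing bijection `θ` of `ℝ` with `θ (t + 1) = θ t + 1` such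
that `T` and `θ` induce the same map on the circle `ℝ/2ℤ = (ℝ² - {0})/ℝ_{>0}`. -/
def coverSubgroup : Subgroup (GL(2, ℝ)⁺ × (ℝ ≃o ℝ)) where
  carrier := {g | (∀ t, g.2 (t + 1) = g.2 t + 1) ∧
    ∀ t, ∃ r : ℝ, 0 < r ∧ planeMap g.1.1 (ray t) = r • ray (g.2 t)}
  mul_mem' := by
    rintro ⟨S, α⟩ ⟨T, β⟩ ⟨h₁, h₂⟩ ⟨h₃, h₄⟩
    refine ⟨fun t => ?_, fun t => ?_⟩
    · simp only [Prod.mk_mul_mk, RelIso.mul_apply] at *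
      rw [h₃, h₁]
    · obtain ⟨r, hr, hr'⟩ := h₄ t
      obtain ⟨s, hs, hs'⟩ := h₂ (β t)
      refine ⟨r * s, mul_pos hr hs, ?_⟩
      simp only [Prod.mk_mul_mk, RelIso.mul_apply, Subgroup.coe_mul, planeMap_mul,
        LinearMap.comp_apply] at *
      rw [hr', map_smul, hs', smul_smul]
  one_mem' := by
    refine ⟨fun t => rfl, fun t => ⟨1, one_pos, ?_⟩⟩
    simp [planeMap_one]
  inv_mem' := by
    rintro ⟨S, α⟩ ⟨h₁, h₂⟩
    have key : ∀ t, α (α⁻¹ t) = t := fun t => RelIso.apply_inv_self α t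
    refine ⟨fun t => ?_, fun t => ?_⟩
    · apply α.injective
      simp only [Prod.inv_mk] at *
      rw [h₁, key, key]
    · obtain ⟨r, hr, hr'⟩ := h₂ (α⁻¹ t)
      refine ⟨r⁻¹, inv_pos.2 hr, ?_⟩
      simp only [Prod.inv_mk, Subgroup.coe_inv] at *
      rw [key] at hr'
      have := congrArg (planeMap (S : GL (Fin 2) ℝ)⁻¹) hr'
      rw [planeMap_inv_apply, map_smul] at this
      rw [this, smul_smul, inv_mul_cancel₀ hr.ne', one_smul]

/-- The universal cover `G` of `GL₂⁺(ℝ)`. -/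
def G : Type := coverSubgroup

noncomputable instance : Group G := inferInstanceAs (Group coverSubgroup)

namespace G

/-- The projection to `GL₂⁺(ℝ)`. -/
noncomputable def T : G →* GL(2, ℝ)⁺ := (MonoidHom.fst _ _).comp coverSubgroup.subtype

/-- The increasing map `θ_g` of the line of phases. -/
noncomputable def θ : G →* (ℝ ≃o ℝ) := (MonoidHom.snd _ _).comp coverSubgroup.subtype

theorem θ_add_one (g : G) (t : ℝ) : θ g (t + 1) = θ g t + 1 := g.2.1 t

theorem exists_planeMap_ray (g : G) (t : ℝ) :
    ∃ r : ℝ, 0 < r ∧ planeMap (T g : GL (Fin 2) ℝ) (ray t) = r • ray (θ g t) := g.2.2 t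

/-- The element of `G` attached to a complex number `z`: the conformal map of multiplication by
`exp(iπz)`, with the translation by `re z` of the phases. -/
noncomputable def ofComplex (z : ℂ) : G :=
  ⟨(⟨Units.map (Algebra.leftMulMatrix Complex.basisOneI : ℂ →* Matrix (Fin 2) (Fin 2) ℝ)
      (Units.mk0 (Complex.exp (Complex.I * Real.pi * z)) (Complex.exp_ne_zero _)), by
        rw [Matrix.mem_glpos]
        simp only [Matrix.GeneralLinearGroup.val_det_apply, Units.coe_map, Units.val_mk0,
          MonoidHom.coe_coe]
        rw [← Algebra.norm_eq_matrix_det, Algebra.norm_complex_apply]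
        exact Complex.normSq_pos.2 (Complex.exp_ne_zero _)⟩,
    OrderIso.addRight z.re), by
      refine ⟨fun t => ?_, fun t => ⟨Real.exp (-(Real.pi * z.im)), Real.exp_pos _, ?_⟩⟩
      · simp only [OrderIso.addRight_apply]
        ring
      · have h : ∀ w y : ℂ, Matrix.toLin Complex.basisOneI Complex.basisOneI
            (Algebra.leftMulMatrix Complex.basisOneI w) y = w * y := by
          intro w y
          rw [Algebra.leftMulMatrix_apply, Matrix.toLin_toMatrix]
          rfl
        simp only [planeMap, Units.coe_map, Units.val_mk0, MonoidHom.coe_coe, h, ray,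
          OrderIso.addRight_apply, Complex.real_smul, Complex.ofReal_exp, ← Complex.exp_add]
        congr 1
        conv_lhs => rw [← Complex.re_add_im z]
        push_cast
        linear_combination (Real.pi * z.im : ℂ) * Complex.I_sq⟩

theorem ofComplex_zero : ofComplex 0 = 1 := by
  refine Subtype.ext (Prod.ext (Subtype.ext (Units.ext ?_)) ?_)
  · simp [ofComplex]
    rfl
  · refine OrderIso.ext (funext fun t => ?_)
    exact add_zero t

theorem ofComplex_add (z w : ℂ) : ofComplex (z + w) = ofComplex z * ofComplex w := by
  refine Subtype.ext (Prod.ext (Subtype.ext (Units.ext ?_)) ?_)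
  · change Algebra.leftMulMatrix Complex.basisOneI _ =
      Algebra.leftMulMatrix Complex.basisOneI _ * Algebra.leftMulMatrix Complex.basisOneI _
    rw [← map_mul, Units.val_mk0, Units.val_mk0, Units.val_mk0, ← Complex.exp_add, mul_add]
  · refine OrderIso.ext (funext fun t => ?_)
    change t + (z.re + w.re) = t + w.re + z.re
    ring

/-- The supremum norm of `θ_g - id`; the supremum is over a bounded set, see
`bddAbove_phaseShift`. -/
noncomputable def phaseShift (g : G) : ℝ := ⨆ t : ℝ, |θ g t - t|

theorem bddAbove_phaseShift (g : G) : BddAbove (Set.range fun t : ℝ => |θ g t - t|) := by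
  have hnat : ∀ (n : ℕ) (t : ℝ), θ g (t + n) = θ g t + n := by
    intro n
    induction n with
    | zero => intro t; simp
    | succ n ih => intro t; push_cast; rw [← add_assoc, θ_add_one, ih, add_assoc]
  have hint : ∀ (n : ℤ) (t : ℝ), θ g (t + n) = θ g t + n := by
    intro n t
    obtain ⟨k, rfl | rfl⟩ := n.eq_nat_or_neg
    · exact_mod_cast hnat k t
    · have := hnat k (t + -(k : ℝ))
      rw [neg_add_cancel_right] at this
      push_cast
      linarith
  refine ⟨|θ g 0| + 1, ?_⟩
  rintro _ ⟨t, rfl⟩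
  have h0 := hint ⌊t⌋ 0
  have h1 := hint (⌊t⌋ + 1) 0
  rw [zero_add] at h0 h1
  push_cast at h1
  have a := (θ g).monotone (Int.floor_le t)
  have b := (θ g).monotone (Int.lt_floor_add_one t).le
  have c := Int.floor_le t
  have d := Int.lt_floor_add_one t
  have e := neg_abs_le (θ g 0)
  have f := le_abs_self (θ g 0)
  exact abs_le.2 ⟨by linarith, by linarith⟩

/-- `Δ(g) = max {‖θ_g - id‖, log ‖T_g‖, log ‖T_g⁻¹‖}`. -/
noncomputable def Δ (g : G) : ℝ :=
  max (phaseShift g) (max (Real.log (opNorm (T g : GL (Fin 2) ℝ)))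
    (Real.log (opNorm (T g : GL (Fin 2) ℝ)⁻¹)))

end G

section Action

variable {C : Type u} [Category.{v} C] [Preadditive C] [HasZeroObject C]
  [HasShift C ℤ] [∀ n : ℤ, (shiftFunctor C n).Additive] [Pretriangulated C]

/-- A filtration for `P`, seen as one for `P ∘ θ`. -/
noncomputable def HNFiltration.reparam {P : ℝ → ObjectProperty C} {c : C} (F : HNFiltration P c)
    (θ : ℝ ≃o ℝ) : HNFiltration (fun φ => P (θ φ)) c where
  len := F.len
  obj := F.obj
  factor := F.factor
  phase j := θ.symm (F.phase j)
  isZero_zero := F.isZero_zero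
  last_iso := F.last_iso
  triangle := F.triangle
  factor_nonzero := F.factor_nonzero
  factor_mem j := by simpa using F.factor_mem j
  phase_anti _ _ h := θ.symm.strictMono (F.phase_anti h)

namespace StabilityCondition

/-- The right action `(Z, P) ↦ (T_g⁻¹ ∘ Z, P ∘ θ_g)`. -/
noncomputable def act (σ : StabilityCondition C) (g : G) : StabilityCondition C where
  Z := (planeMap (G.T g : GL (Fin 2) ℝ)⁻¹).toAddMonoidHom.comp σ.Z
  P φ := σ.P (G.θ g φ)
  mem_of_iso _ _ _ e h := σ.mem_of_iso _ e h
  mem_of_isZero _ _ h := σ.mem_of_isZero _ h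
  mem_biprod _ _ _ t ht ha hb := σ.mem_biprod _ t ht ha hb
  charge φ c hc h0 := by
    obtain ⟨m, hm, h⟩ := σ.charge _ c hc h0
    obtain ⟨r, hr, h'⟩ := G.exists_planeMap_ray g φ
    refine ⟨m / r, div_pos hm hr, ?_⟩
    have h'' := congrArg (planeMap (G.T g : GL (Fin 2) ℝ)⁻¹) h'
    rw [planeMap_inv_apply, map_smul] at h''
    change planeMap (G.T g : GL (Fin 2) ℝ)⁻¹ (σ.Z (K₀.cls c)) = ((m / r : ℝ) : ℂ) * ray φ
    rw [h, ← Complex.real_smul, map_smul, h'', ← Complex.real_smul, smul_smul,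
      div_mul_cancel₀ _ hr.ne']
    rfl
  shift φ c := by rw [G.θ_add_one, σ.shift]
  hom_eq_zero φ ψ a b h ha hb := σ.hom_eq_zero _ _ a b ((G.θ g).strictMono h) ha hb
  exists_HN c hc := (σ.exists_HN c hc).map fun F => F.reparam (G.θ g)

theorem act_one (σ : StabilityCondition C) : σ.act 1 = σ := by
  refine StabilityCondition.ext (AddMonoidHom.ext fun x => ?_) ?_
  · change planeMap (G.T 1 : GL (Fin 2) ℝ)⁻¹ (σ.Z x) = σ.Z x
    rw [map_one, Subgroup.coe_one, inv_one, planeMap_one, LinearMap.id_apply]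
  · funext φ
    change σ.P (G.θ 1 φ) = σ.P φ
    rw [map_one]
    rfl

theorem act_mul (σ : StabilityCondition C) (g h : G) : σ.act (g * h) = (σ.act g).act h := by
  refine StabilityCondition.ext (AddMonoidHom.ext fun x => ?_) ?_
  · change planeMap (G.T (g * h) : GL (Fin 2) ℝ)⁻¹ (σ.Z x) =
      planeMap (G.T h : GL (Fin 2) ℝ)⁻¹ (planeMap (G.T g : GL (Fin 2) ℝ)⁻¹ (σ.Z x))
    rw [map_mul, Subgroup.coe_mul, mul_inv_rev, planeMap_mul, LinearMap.comp_apply]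
  · funext φ
    change σ.P (G.θ (g * h) φ) = σ.P (G.θ g (G.θ h φ))
    rw [map_mul]
    rfl

theorem LocallyFinite.act {σ : StabilityCondition C} (hσ : σ.LocallyFinite) (g : G) :
    (σ.act g).LocallyFinite := by
  intro t
  obtain ⟨ε, hε, -, hN, hA⟩ := hσ (G.θ g t)
  have hc : ContinuousAt (G.θ g) t := (G.θ g).continuous.continuousAt
  obtain ⟨δ, hδ, hδ'⟩ := Metric.continuousAt_iff.1 hc ε hε
  have key : ∀ c, (σ.act g).PI (Set.Ioo (t - min δ (1 / 4)) (t + min δ (1 / 4))) c →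
      σ.PI (Set.Ioo (G.θ g t - ε) (G.θ g t + ε)) c := by
    intro c hc
    refine ExtClosure.mono ?_ hc
    rintro b ⟨φ, hφ, hb⟩
    refine ⟨G.θ g φ, ?_, hb⟩
    have h1 : |φ - t| < δ := by
      have := min_le_left δ (1 / 4)
      exact abs_lt.2 ⟨by linarith [hφ.1], by linarith [hφ.2]⟩
    have h2 := hδ' (x := φ) (by rwa [Real.dist_eq])
    rw [Real.dist_eq, abs_lt] at h2
    exact ⟨by linarith [h2.1], by linarith [h2.2]⟩
  refine ⟨min δ (1 / 4), by positivity, ?_, hN.anti key, hA.anti key⟩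
  have := min_le_right δ (1 / 4)
  linarith

end StabilityCondition

variable (C) in
/-- The space of locally-finite stability conditions. -/
def Stab := {σ : StabilityCondition C // σ.LocallyFinite}

/-- The right action of `G` on the space of stability conditions; `σ <• g` stands for the right
translate `σ g`. -/
noncomputable instance : MulAction Gᵐᵒᵖ (Stab C) where
  smul g σ := ⟨σ.1.act g.unop, σ.2.act g.unop⟩
  one_smul σ := Subtype.ext σ.1.act_one
  mul_smul g h σ := Subtype.ext (σ.1.act_mul h.unop g.unop)

namespace Stab

/-- The generalised metric on the space of stability conditions, with values in `[0, ∞]`. -/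
noncomputable def d (σ τ : Stab C) : ℝ≥0∞ :=
  ⨆ c : {c : C // ¬ IsZero c}, ENNReal.ofReal
    (max |σ.1.phaseMin c - τ.1.phaseMin c| (max |σ.1.phaseMax c - τ.1.phaseMax c|
      |Real.log (σ.1.mass c / τ.1.mass c)|))

/-- The orbit `σG`. -/
abbrev Orbit (σ : Stab C) := {τ : Stab C // τ ∈ MulAction.orbit Gᵐᵒᵖ σ}

/-- The element `σ g` of the orbit `σG`. -/
noncomputable def Orbit.mk (σ : Stab C) (g : G) : Orbit σ :=
  ⟨σ <• g, MulAction.mem_orbit σ (MulOpposite.op g)⟩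

/-- Two points of `σG` are equivalent if they lie in the same orbit of `ℂ`. -/
def complexSetoid (σ : Stab C) : Setoid (Orbit σ) where
  r x y := ∃ z : ℂ, y.1 = x.1 <• G.ofComplex z
  iseqv :=
    { refl := fun x => ⟨0, by rw [G.ofComplex_zero, MulOpposite.op_one, one_smul]⟩
      symm := by
        rintro x y ⟨z, hz⟩
        refine ⟨-z, ?_⟩
        rw [hz, smul_smul, ← MulOpposite.op_mul, ← G.ofComplex_add, add_neg_cancel,
          G.ofComplex_zero, MulOpposite.op_one, one_smul]
      trans := by
        rintro x y w ⟨z, hz⟩ ⟨z', hz'⟩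
        refine ⟨z + z', ?_⟩
        rw [hz', hz, smul_smul, ← MulOpposite.op_mul, ← G.ofComplex_add] }

/-- The quotient metric, `inf {d(x, y z) | z ∈ ℂ}`, in terms of representatives. -/
noncomputable def quotDist (x y : Stab C) : ℝ≥0∞ := ⨅ z : ℂ, d x (y <• G.ofComplex z)

end Stab

end Action

end Stability

namespace Stability

/-! ### Independence of phases and mass from the Harder–Narasimhan filtration -/

section HarderNarasimhan

variable {C : Type u} [Category.{v} C] [Preadditive C] [HasZeroObject C]
  [HasShift C ℤ] [∀ n : ℤ, (shiftFunctor C n).Additive] [Pretriangulated C]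

/-! An HN filtration of `c` for `σ` becomes one for `σ g` when its phases are moved by `θ_g⁻¹`, and
its charges are moved by `T_g⁻¹`. So the metric on the orbit only involves how `g⁻¹` and `h⁻¹` move
the rays of the plane, once phases and mass are known not to depend on the filtration. For that, the
part of `c` of phase at least `t` is a coreflection, hence unique; its charge determines, by varying
`t`, the charges of the factors phase by phase (`sum_charge_phase_eq`).

Write `logStretch g t` for the logarithm of the factor by which `T_g` stretches the ray of phase
`t`. Then `Δ g` is the supremum over `t` of `|θ_g t - t|` and `|logStretch g t|` (`G.Δ_le_iff`).
Both quantities are additive cocycles, so `Δ` is a length function on `G`. A semistable object of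
phase `φ` tests the difference of `g⁻¹` and `h⁻¹` exactly at `φ`; as such phases are dense and
everything is continuous, `d (σ g) (σ h) = Δ (h⁻¹ g)` (`Stab.d_act`). Freeness follows because `Δ`
vanishes only at `1`. Completeness holds because uniform limits of the phase maps and log-stretches
of the inverses again come from `G`.

For the quotient, write `T z = α z + β conj z`. The largest and smallest stretches are `|α| + |β|`
and `|α| - |β|`, while `tanh (dist (T • i) i / 2) = |β| / |α|`; so their ratio is `exp (dist (T • i)
i)`, which forces `Δ g ≥ dist (T_g • i) i / 2`. Multiplication by a complex number centres the
stretches around `1`, and a suitable lift rotates phases by less than that bound, so equality is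
reached modulo `ℂ` (`G.exists_Δ_le`). Since `ℂ` fixes `i` and `GL₂⁺(ℝ)` acts by isometries, this
computes the quotient metric between any two points. -/

theorem K₀.cls_eq_add {a b c : C} {f : a ⟶ b} {g : b ⟶ c} {h : c ⟶ a⟦(1 : ℤ)⟧}
    (hT : Triangle.mk f g h ∈ distTriang C) : K₀.cls b = K₀.cls a + K₀.cls c := by
  rw [← sub_eq_zero, ← sub_sub]
  exact (QuotientAddGroup.eq_zero_iff _).2 (AddSubgroup.subset_closure ⟨_, hT, rfl⟩)

open scoped ZeroObject in
theorem K₀.cls_congr {a b : C} (e : a ≅ b) : K₀.cls a = K₀.cls b := by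
  have h₀ : K₀.cls (0 : C) = 0 := by
    simpa using K₀.cls_eq_add (contractible_distinguished (0 : C))
  have h := K₀.cls_eq_add (isomorphic_distinguished _ (contractible_distinguished a)
    (Triangle.mk e.hom (0 : b ⟶ 0) 0)
    (Triangle.isoMk _ _ (Iso.refl a) e.symm (Iso.refl 0)
      (e.hom_inv_id.trans (Category.id_comp _).symm) ((isZero_zero C).eq_of_tgt _ _)
      ((isZero_zero C).eq_of_src _ _)))
  simpa [h₀] using h.symm

theorem K₀.cls_of_isZero {c : C} (hc : IsZero c) : K₀.cls c = 0 := by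
  have h := K₀.cls_eq_add (contractible_distinguished c)
  have h' := K₀.cls_congr (hc.iso (isZero_zero C))
  rw [← h'] at h
  simpa using h

namespace StabilityCondition

variable (σ : StabilityCondition C)

/-- The objects without nonzero maps to semistable objects of phase less than `t`. -/
def IsGE (t : ℝ) : ObjectProperty C := fun x => ∀ ψ < t, ∀ b, σ.P ψ b → ∀ f : x ⟶ b, f = 0

variable {σ}

theorem IsGE.of_mem {t φ : ℝ} (h : t ≤ φ) {b : C} (hb : σ.P φ b) : σ.IsGE t b :=
  fun ψ hψ b' hb' f => σ.hom_eq_zero φ ψ b b' (hψ.trans_le h) hb hb' f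

theorem IsGE.of_isZero {t : ℝ} {x : C} (hx : IsZero x) : σ.IsGE t x :=
  fun _ _ _ _ _ => hx.eq_of_src _ _

theorem IsGE.ext {t : ℝ} {T : Triangle C} (hT : T ∈ distTriang C) (h₁ : σ.IsGE t T.obj₁)
    (h₃ : σ.IsGE t T.obj₃) : σ.IsGE t T.obj₂ := by
  intro ψ hψ b hb f
  obtain ⟨g, rfl⟩ := Triangle.yoneda_exact₂ T hT f (h₁ ψ hψ b hb _)
  rw [h₃ ψ hψ b hb g, comp_zero]

theorem mem_shift_neg_one {ψ : ℝ} {b : C} (hb : σ.P ψ b) : σ.P (ψ - 1) (b⟦(-1 : ℤ)⟧) := by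
  rw [← σ.shift, sub_add_cancel]
  exact σ.mem_of_iso _ (shiftNegShift b (1 : ℤ)).symm hb

/-- By the long exact sequence, the obstructions are maps from `x` to `T.obj₃` and to `T.obj₃⟦-1⟧`.
These are semistable of phases `ψ` and `ψ - 1`, both below `t`, so all such maps vanish. -/
theorem bijective_comp_of_isGE {T : Triangle C} (hT : T ∈ distTriang C) {t ψ : ℝ} (hψ : ψ < t)
    (hb : σ.P ψ T.obj₃) {x : C} (hx : σ.IsGE t x) :
    Function.Bijective fun f : x ⟶ T.obj₁ => f ≫ T.mor₁ := by
  refine ⟨fun f f' h => ?_, fun f => ?_⟩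
  · have h0 : (f - f') ≫ T.mor₁ = 0 := by
      rw [Preadditive.sub_comp, sub_eq_zero]
      exact h
    obtain ⟨g, hg⟩ := Triangle.coyoneda_exact₂ T.invRotate (inv_rot_of_distTriang T hT) (f - f') h0
    rw [hx (ψ - 1) (by linarith) _ (mem_shift_neg_one hb) g] at hg
    exact sub_eq_zero.1 (hg.trans zero_comp)
  · obtain ⟨g, hg⟩ := Triangle.coyoneda_exact₂ T hT f (hx ψ hψ _ hb _)
    exact ⟨g, hg.symm⟩

/-- A coreflection of `c` into `σ.IsGE t`. -/
structure Coreflects (σ : StabilityCondition C) (t : ℝ) {a c : C} (i : a ⟶ c) : Prop where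
  isGE : σ.IsGE t a
  bijective : ∀ x, σ.IsGE t x → Function.Bijective fun f : x ⟶ a => f ≫ i

theorem Coreflects.cls_eq {t : ℝ} {a a' c : C} {i : a ⟶ c} {i' : a' ⟶ c}
    (h : σ.Coreflects t i) (h' : σ.Coreflects t i') : K₀.cls a = K₀.cls a' := by
  obtain ⟨f, hf⟩ := (h'.bijective a h.isGE).2 i
  obtain ⟨g, hg⟩ := (h.bijective a' h'.isGE).2 i'
  dsimp only at hf hg
  refine K₀.cls_congr ⟨f, g, ?_, ?_⟩
  · apply (h.bijective a h.isGE).1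
    simp [hf, hg]
  · apply (h'.bijective a' h'.isGE).1
    simp [hf, hg]

end StabilityCondition

namespace HNFiltration

open StabilityCondition

variable {σ : StabilityCondition C} {c : C} (F : HNFiltration σ.P c)

theorem isGE_obj {t : ℝ} (k : Fin (F.len + 2))
    (hk : ∀ j : Fin (F.len + 1), j.castSucc < k → t ≤ F.phase j) :
    σ.IsGE t (F.obj k) ∧ K₀.cls (F.obj k) =
      ∑ j with j.castSucc < k ∧ t ≤ F.phase j, K₀.cls (F.factor j) := by
  induction k using Fin.induction with
  | zero =>
    refine ⟨.of_isZero F.isZero_zero, ?_⟩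
    simp [K₀.cls_of_isZero F.isZero_zero]
  | succ k ih =>
    obtain ⟨f, g, h, hT⟩ := F.triangle k
    obtain ⟨h₁, h₂⟩ := ih fun j hj => hk j (hj.trans k.castSucc_lt_succ)
    have hk' := hk k k.castSucc_lt_succ
    refine ⟨IsGE.ext hT h₁ (.of_mem hk' (F.factor_mem k)), ?_⟩
    rw [K₀.cls_eq_add hT, h₂, add_comm, ← Finset.sum_filter_add_sum_filter_not
      {j | j.castSucc < k.succ ∧ t ≤ F.phase j} (fun j => j = k)]
    congr 1
    · rw [Finset.sum_eq_single k] <;> simp +contextual [hk']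
    · congr 1
      ext j
      simp only [Finset.mem_filter, Finset.mem_univ, true_and, Fin.castSucc_lt_castSucc_iff,
        Fin.castSucc_lt_succ_iff]
      rw [lt_iff_le_and_ne]
      tauto

/-- The phases decrease along the chain. As long as they are at least `t`, the object is its own
coreflection; after that, each further factor has phase below `t` and leaves the coreflection
unchanged by `bijective_comp_of_isGE`. -/
theorem exists_coreflects_obj (t : ℝ) (k : Fin (F.len + 2)) :
    ∃ (a : C) (i : a ⟶ F.obj k), σ.Coreflects t i ∧ K₀.cls a =
      ∑ j with j.castSucc < k ∧ t ≤ F.phase j, K₀.cls (F.factor j) := by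
  have hid : ∀ k : Fin (F.len + 2), (∀ j : Fin (F.len + 1), j.castSucc < k → t ≤ F.phase j) →
      ∃ (a : C) (i : a ⟶ F.obj k), σ.Coreflects t i ∧ K₀.cls a =
        ∑ j with j.castSucc < k ∧ t ≤ F.phase j, K₀.cls (F.factor j) := by
    intro k hk
    obtain ⟨h₁, h₂⟩ := F.isGE_obj k hk
    refine ⟨F.obj k, 𝟙 _, ⟨h₁, fun x _ => ?_⟩, h₂⟩
    simp only [Category.comp_id]
    exact Function.bijective_id
  induction k using Fin.induction with
  | zero => exact hid 0 (by simp)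
  | succ k ih =>
    rcases le_or_gt t (F.phase k) with hk | hk
    · exact hid _ fun j hj => hk.trans (F.phase_anti.antitone (Fin.castSucc_lt_succ_iff.1 hj))
    · obtain ⟨f, g, h, hT⟩ := F.triangle k
      obtain ⟨a, i, hi, hc⟩ := ih
      refine ⟨a, i ≫ f, ⟨hi.isGE, fun x hx => ?_⟩, ?_⟩
      · have h₁ : Function.Bijective fun u : x ⟶ F.obj k.castSucc => u ≫ f :=
          bijective_comp_of_isGE hT hk (F.factor_mem k) hx
        simpa only [Function.comp_def, Category.assoc] using h₁.comp (hi.bijective x hx)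
      · rw [hc]
        congr 1
        ext j
        simp only [Finset.mem_filter, Finset.mem_univ, true_and, Fin.castSucc_lt_castSucc_iff,
          Fin.castSucc_lt_succ_iff]
        refine ⟨fun h => ⟨h.1.le, h.2⟩, fun h => ⟨h.1.lt_of_ne ?_, h.2⟩⟩
        rintro rfl
        exact hk.not_ge h.2

theorem exists_coreflects (t : ℝ) :
    ∃ (a : C) (i : a ⟶ c), σ.Coreflects t i ∧ K₀.cls a =
      ∑ j with t ≤ F.phase j, K₀.cls (F.factor j) := by
  obtain ⟨a, i, hi, hc⟩ := F.exists_coreflects_obj t (Fin.last _)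
  obtain ⟨e⟩ := F.last_iso
  refine ⟨a, i ≫ e.hom, ⟨hi.isGE, fun x hx => ?_⟩, ?_⟩
  · have he : Function.Bijective fun f : x ⟶ F.obj (Fin.last _) => f ≫ e.hom :=
      ⟨fun f f' h => (cancel_mono e.hom).1 h, fun f => ⟨f ≫ e.inv, by simp⟩⟩
    simpa [Function.comp_def] using he.comp (hi.bijective x hx)
  · simpa [Fin.castSucc_lt_last] using hc

theorem sum_charge_ge_eq (F' : HNFiltration σ.P c) (t : ℝ) :
    ∑ j with t ≤ F.phase j, σ.Z (K₀.cls (F.factor j)) =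
      ∑ j with t ≤ F'.phase j, σ.Z (K₀.cls (F'.factor j)) := by
  obtain ⟨a, i, hi, hc⟩ := F.exists_coreflects t
  obtain ⟨a', i', hi', hc'⟩ := F'.exists_coreflects t
  rw [← map_sum, ← map_sum, ← hc, ← hc', hi.cls_eq hi']

open Filter Topology in
-- For `t` slightly above `φ`, truncating at `t` removes precisely the factors of phase at most `φ`,
-- so the factor of phase `φ` is the difference of the truncations at `φ` and at `t`. One such `t`
-- serves two filtrations at once.
theorem eventually_le_phase_iff (φ : ℝ) :
    ∀ᶠ t in 𝓝[>] φ, ∀ j, t ≤ F.phase j ↔ φ < F.phase j := by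
  refine eventually_all.2 fun j => ?_
  rcases lt_or_ge φ (F.phase j) with h | h
  · filter_upwards [mem_nhdsWithin_of_mem_nhds (Iio_mem_nhds h)] with t ht
    exact ⟨fun _ => h, fun _ => le_of_lt ht⟩
  · filter_upwards [self_mem_nhdsWithin] with t ht
    exact ⟨fun h' => absurd (h'.trans h) (not_le.2 ht), fun h' => absurd h' (not_lt.2 h)⟩

theorem sum_filter_phase_eq (φ t : ℝ) (ht : ∀ j, t ≤ F.phase j ↔ φ < F.phase j) :
    ∑ j with F.phase j = φ, σ.Z (K₀.cls (F.factor j)) =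
      ∑ j with φ ≤ F.phase j, σ.Z (K₀.cls (F.factor j)) -
        ∑ j with t ≤ F.phase j, σ.Z (K₀.cls (F.factor j)) := by
  rw [eq_sub_iff_add_eq, ← Finset.sum_union]
  · congr 1
    ext j
    simp only [Finset.mem_union, Finset.mem_filter, Finset.mem_univ, true_and, ht]
    rw [le_iff_eq_or_lt, eq_comm]
  · rw [Finset.disjoint_filter]
    rintro j - h h'
    exact ((ht j).1 h').ne' h

theorem sum_charge_phase_eq (F' : HNFiltration σ.P c) (φ : ℝ) :
    ∑ j with F.phase j = φ, σ.Z (K₀.cls (F.factor j)) =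
      ∑ j with F'.phase j = φ, σ.Z (K₀.cls (F'.factor j)) := by
  obtain ⟨t, h, h'⟩ := ((F.eventually_le_phase_iff φ).and (F'.eventually_le_phase_iff φ)).exists
  rw [F.sum_filter_phase_eq φ t h, F'.sum_filter_phase_eq φ t h', F.sum_charge_ge_eq F',
    F.sum_charge_ge_eq F']

theorem charge_factor_ne_zero (j : Fin (F.len + 1)) : σ.Z (K₀.cls (F.factor j)) ≠ 0 := by
  obtain ⟨m, hm, h⟩ := σ.charge _ _ (F.factor_mem j) (F.factor_nonzero j)
  rw [h]
  exact mul_ne_zero (by exact_mod_cast hm.ne') (Complex.exp_ne_zero _)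

theorem sum_charge_phase_self (j : Fin (F.len + 1)) :
    ∑ k with F.phase k = F.phase j, σ.Z (K₀.cls (F.factor k)) = σ.Z (K₀.cls (F.factor j)) := by
  simp [F.phase_anti.injective.eq_iff, Finset.filter_eq']

/-- A phase missing from `F'` would have total charge zero there, but a factor of `F` has nonzero
charge. -/
theorem range_phase_subset (F' : HNFiltration σ.P c) :
    Set.range F.phase ⊆ Set.range F'.phase := by
  rintro _ ⟨j, rfl⟩
  by_contra h
  apply F.charge_factor_ne_zero j
  rw [← sum_charge_phase_self, F.sum_charge_phase_eq F', Finset.sum_eq_zero]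
  intro k hk
  exact absurd ⟨k, (Finset.mem_filter.1 hk).2⟩ h

theorem phase_zero_le (F' : HNFiltration σ.P c) : F.phase 0 ≤ F'.phase 0 := by
  obtain ⟨j, hj⟩ := F.range_phase_subset F' ⟨0, rfl⟩
  exact hj ▸ F'.phase_anti.antitone (Fin.zero_le j)

theorem phase_last_le (F' : HNFiltration σ.P c) :
    F.phase (Fin.last _) ≤ F'.phase (Fin.last _) := by
  obtain ⟨j, hj⟩ := F'.range_phase_subset F ⟨Fin.last _, rfl⟩
  exact hj ▸ F.phase_anti.antitone (Fin.le_last j)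

theorem sum_norm_charge_eq_sum_image (F' : HNFiltration σ.P c) :
    ∑ j, ‖σ.Z (K₀.cls (F.factor j))‖ = ∑ φ ∈ Finset.univ.image F.phase,
      ‖∑ j with F'.phase j = φ, σ.Z (K₀.cls (F'.factor j))‖ := by
  rw [Finset.sum_image fun _ _ _ _ h => F.phase_anti.injective h]
  refine Finset.sum_congr rfl fun j _ => ?_
  rw [← F.sum_charge_phase_eq F', sum_charge_phase_self]

theorem sum_norm_charge_eq (F' : HNFiltration σ.P c) :
    ∑ j, ‖σ.Z (K₀.cls (F.factor j))‖ = ∑ j, ‖σ.Z (K₀.cls (F'.factor j))‖ := by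
  rw [F.sum_norm_charge_eq_sum_image F', F'.sum_norm_charge_eq_sum_image F']
  congr 1
  apply Finset.coe_injective
  push_cast
  simp only [Set.image_univ]
  exact (F.range_phase_subset F').antisymm (F'.range_phase_subset F)

end HNFiltration

namespace StabilityCondition

variable (σ : StabilityCondition C) (c : {c : C // ¬ IsZero c})

theorem phaseMax_eq (F : HNFiltration σ.P c.1) : σ.phaseMax c = F.phase 0 :=
  ((σ.hn c).phase_zero_le F).antisymm (F.phase_zero_le _)

theorem phaseMin_eq (F : HNFiltration σ.P c.1) : σ.phaseMin c = F.phase (Fin.last _) :=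
  ((σ.hn c).phase_last_le F).antisymm (F.phase_last_le _)

theorem mass_eq (F : HNFiltration σ.P c.1) :
    σ.mass c = ∑ j, ‖σ.Z (K₀.cls (F.factor j))‖ :=
  (σ.hn c).sum_norm_charge_eq F

/-- Since any filtration may be used, the one chosen for `σ` is reparametrised instead of choosing a
new one for `σ g`. -/
theorem phaseMax_act (g : G) : (σ.act g).phaseMax c = (G.θ g).symm (σ.phaseMax c) :=
  (σ.act g).phaseMax_eq c ((σ.hn c).reparam (G.θ g))

theorem phaseMin_act (g : G) : (σ.act g).phaseMin c = (G.θ g).symm (σ.phaseMin c) :=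
  (σ.act g).phaseMin_eq c ((σ.hn c).reparam (G.θ g))

theorem mass_act (g : G) : (σ.act g).mass c =
    ∑ j, ‖planeMap (G.T g : GL (Fin 2) ℝ)⁻¹ (σ.Z (K₀.cls ((σ.hn c).factor j)))‖ :=
  (σ.act g).mass_eq c ((σ.hn c).reparam (G.θ g))

end StabilityCondition

open scoped ZeroObject in
/-- The Harder-Narasimhan filtration of a semistable object. -/
noncomputable def HNFiltration.ofSemistable {σ : StabilityCondition C} {φ : ℝ} {c : C}
    (hc : σ.P φ c) (h₀ : ¬ IsZero c) : HNFiltration σ.P c where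
  len := 0
  obj := ![0, c]
  factor := fun _ => c
  phase := fun _ => φ
  isZero_zero := CategoryTheory.Limits.isZero_zero C
  last_iso := ⟨Iso.refl c⟩
  triangle j := by
    fin_cases j
    exact ⟨0, 𝟙 c, 0, contractible_distinguished₁ c⟩
  factor_nonzero _ := h₀
  factor_mem _ := hc
  phase_anti i j h := absurd h (by simp [Fin.fin_one_eq_zero i, Fin.fin_one_eq_zero j])

namespace StabilityCondition

theorem phaseMax_of_mem (σ : StabilityCondition C) (c : {c : C // ¬ IsZero c}) {φ : ℝ}
    (hc : σ.P φ c.1) : σ.phaseMax c = φ :=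
  σ.phaseMax_eq c (.ofSemistable hc c.2)

theorem mass_act_of_mem (σ : StabilityCondition C) (c : {c : C // ¬ IsZero c}) {φ : ℝ}
    (hc : σ.P φ c.1) (g : G) :
    (σ.act g).mass c = ‖planeMap (G.T g : GL (Fin 2) ℝ)⁻¹ (σ.Z (K₀.cls c.1))‖ := by
  refine ((σ.act g).mass_eq c ((HNFiltration.ofSemistable hc c.2).reparam (G.θ g))).trans ?_
  exact Fin.sum_univ_one _

end StabilityCondition

end HarderNarasimhan

/-! ### Rays, operator norms and the length function `Δ` -/

theorem norm_ray (t : ℝ) : ‖ray t‖ = 1 := by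
  rw [ray, mul_assoc, mul_comm]
  exact_mod_cast Complex.norm_exp_ofReal_mul_I (Real.pi * t)

theorem ray_ne_zero (t : ℝ) : ray t ≠ 0 := Complex.exp_ne_zero _

theorem ray_add (s t : ℝ) : ray (s + t) = ray s * ray t := by
  rw [ray, ray, ray, ← Complex.exp_add]
  push_cast
  ring_nf

theorem ray_zero : ray 0 = 1 := by simp [ray]

theorem ray_eq (t : ℝ) : ray t = Complex.exp (((Real.pi * t : ℝ) : ℂ) * Complex.I) := by
  rw [ray]
  push_cast
  ring_nf

theorem ray_one_half : ray (1 / 2) = Complex.I := by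
  rw [ray_eq, mul_one_div]
  push_cast
  exact Complex.exp_pi_div_two_mul_I

theorem ray_eq_ray_iff {s t : ℝ} : ray s = ray t ↔ ∃ n : ℤ, s = t + 2 * n := by
  rw [ray, ray, Complex.exp_eq_exp_iff_exists_int]
  refine exists_congr fun n => ?_
  have : Complex.I * Real.pi ≠ 0 := mul_ne_zero Complex.I_ne_zero (by exact_mod_cast Real.pi_ne_zero)
  rw [show Complex.I * Real.pi * t + n * (2 * Real.pi * Complex.I) =
    Complex.I * Real.pi * (t + 2 * n : ℂ) by ring, mul_right_inj' this]
  exact_mod_cast Iff.rfl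

theorem exists_eq_smul_ray (z : ℂ) : ∃ t : ℝ, z = ‖z‖ • ray t := by
  refine ⟨z.arg / Real.pi, ?_⟩
  rw [ray_eq, mul_div_cancel₀ _ Real.pi_ne_zero, Complex.real_smul, Complex.norm_mul_exp_arg_mul_I]

theorem eq_of_smul_ray_eq {r s a b : ℝ} (hr : 0 < r) (hs : 0 < s)
    (h : r • ray a = s • ray b) : r = s ∧ ray a = ray b := by
  have := congrArg norm h
  rw [norm_smul, norm_smul, norm_ray, norm_ray, mul_one, mul_one, Real.norm_of_nonneg hr.le,
    Real.norm_of_nonneg hs.le] at this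
  subst this
  exact ⟨rfl, smul_right_injective ℂ hr.ne' h⟩

theorem continuous_ray : Continuous ray := by
  unfold ray
  fun_prop

section PlaneMap

variable (S T : GL (Fin 2) ℝ)

theorem planeMap_apply_inv (z : ℂ) : planeMap T (planeMap T⁻¹ z) = z := by
  simpa using planeMap_inv_apply T⁻¹ z

theorem planeMap_mul_apply (z : ℂ) : planeMap (S * T) z = planeMap S (planeMap T z) := by
  rw [planeMap_mul, LinearMap.comp_apply]

theorem planeMap_injective : Function.Injective (planeMap T) :=
  Function.LeftInverse.injective (planeMap_inv_apply T)

theorem planeMap_ray_ne_zero (t : ℝ) : planeMap T (ray t) ≠ 0 :=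
  (map_ne_zero_iff _ (planeMap_injective T)).2 (ray_ne_zero t)

theorem continuous_planeMap : Continuous (planeMap T) :=
  (planeMap T).continuous_of_finiteDimensional

theorem norm_planeMap_le (z : ℂ) : ‖planeMap T z‖ ≤ opNorm T * ‖z‖ :=
  (LinearMap.toContinuousLinearMap (planeMap T)).le_opNorm z

theorem norm_planeMap_ray_le (t : ℝ) : ‖planeMap T (ray t)‖ ≤ opNorm T := by
  simpa [norm_ray] using norm_planeMap_le T (ray t)

theorem opNorm_pos : 0 < opNorm T :=
  (norm_pos_iff.2 (planeMap_ray_ne_zero T 0)).trans_le (norm_planeMap_ray_le T 0)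

theorem inv_opNorm_inv_le_norm_planeMap_ray (t : ℝ) :
    (opNorm T⁻¹)⁻¹ ≤ ‖planeMap T (ray t)‖ := by
  rw [inv_le_iff_one_le_mul₀' (opNorm_pos _)]
  simpa [planeMap_inv_apply, norm_ray] using norm_planeMap_le T⁻¹ (planeMap T (ray t))

variable {T}

theorem norm_planeMap_le_of_ray {c : ℝ} (h : ∀ t, ‖planeMap T (ray t)‖ ≤ c) (z : ℂ) :
    ‖planeMap T z‖ ≤ c * ‖z‖ := by
  obtain ⟨t, ht⟩ := exists_eq_smul_ray z
  conv_lhs => rw [ht]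
  rw [map_smul, norm_smul, norm_norm, mul_comm]
  exact mul_le_mul_of_nonneg_right (h t) (norm_nonneg _)

theorem opNorm_le_of_ray {c : ℝ} (h : ∀ t, ‖planeMap T (ray t)‖ ≤ c) : opNorm T ≤ c :=
  ContinuousLinearMap.opNorm_le_bound _ ((norm_nonneg (planeMap T (ray 0))).trans (h 0))
    (norm_planeMap_le_of_ray h)

theorem opNorm_inv_le_of_ray {c : ℝ} (hc : 0 < c) (h : ∀ t, c ≤ ‖planeMap T (ray t)‖) :
    opNorm T⁻¹ ≤ c⁻¹ := by
  refine ContinuousLinearMap.opNorm_le_bound _ (inv_pos.2 hc).le fun z => ?_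
  change ‖planeMap T⁻¹ z‖ ≤ _
  obtain ⟨t, ht⟩ := exists_eq_smul_ray (planeMap T⁻¹ z)
  have hz := congrArg norm (planeMap_apply_inv T z)
  rw [ht, map_smul, norm_smul, norm_norm] at hz
  rw [le_inv_mul_iff₀ hc, mul_comm, ← hz]
  exact mul_le_mul_of_nonneg_left (h t) (norm_nonneg _)

end PlaneMap

namespace G

@[ext]
theorem ext {g h : G} (hT : T g = T h) (hθ : ∀ t, θ g t = θ h t) : g = h :=
  Subtype.ext (Prod.ext hT (RelIso.ext hθ))

theorem θ_mul_apply (g h : G) (t : ℝ) : θ (g * h) t = θ g (θ h t) := by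
  rw [map_mul]
  rfl

theorem θ_inv_apply (g : G) (t : ℝ) : θ g⁻¹ t = (θ g).symm t := by
  rw [map_inv]
  rfl

theorem θ_one_apply (t : ℝ) : θ 1 t = t := by
  rw [map_one]
  rfl

theorem θ_inv_θ (g : G) (t : ℝ) : θ g⁻¹ (θ g t) = t := by
  rw [← θ_mul_apply, inv_mul_cancel, θ_one_apply]

theorem continuous_θ (g : G) : Continuous (θ g) := (θ g).continuous

/-- The logarithm of the factor by which `T_g` stretches the ray of phase `t`. -/
noncomputable def logStretch (g : G) (t : ℝ) : ℝ :=
  Real.log ‖planeMap (T g : GL (Fin 2) ℝ) (ray t)‖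

theorem planeMap_ray (g : G) (t : ℝ) :
    planeMap (T g : GL (Fin 2) ℝ) (ray t) = Real.exp (logStretch g t) • ray (θ g t) := by
  obtain ⟨r, hr, h⟩ := exists_planeMap_ray g t
  rw [logStretch, h, norm_smul, norm_ray, mul_one, Real.norm_of_nonneg hr.le, Real.exp_log hr]

theorem exp_logStretch (g : G) (t : ℝ) :
    Real.exp (logStretch g t) = ‖planeMap (T g : GL (Fin 2) ℝ) (ray t)‖ :=
  Real.exp_log (norm_pos_iff.2 (planeMap_ray_ne_zero _ t))

theorem continuous_logStretch (g : G) : Continuous (logStretch g) :=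
  ((continuous_planeMap _).comp continuous_ray).norm.log
    fun t => norm_ne_zero_iff.2 (planeMap_ray_ne_zero _ t)

/-- This cocycle rule, parallel to that of `θ`, is the source of the triangle inequality and of the
symmetry of `Δ`. -/
theorem logStretch_mul (g h : G) (t : ℝ) :
    logStretch (g * h) t = logStretch h t + logStretch g (θ h t) := by
  rw [← Real.exp_eq_exp, Real.exp_add, exp_logStretch, map_mul, Subgroup.coe_mul,
    planeMap_mul_apply, planeMap_ray h, map_smul, norm_smul, ← exp_logStretch,
    Real.norm_of_nonneg (Real.exp_pos _).le]

theorem logStretch_one (t : ℝ) : logStretch 1 t = 0 := by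
  simp [logStretch, planeMap_one, norm_ray]

theorem logStretch_inv_θ (g : G) (t : ℝ) : logStretch g⁻¹ (θ g t) = -logStretch g t := by
  have := logStretch_mul g⁻¹ g t
  rw [inv_mul_cancel, logStretch_one] at this
  linarith

theorem Δ_nonneg (g : G) : 0 ≤ Δ g :=
  (Real.iSup_nonneg fun _ => abs_nonneg _).trans (le_max_left _ _)

/-- The norm of `T_g` is its largest stretch of a ray, and the norm of `T_g⁻¹` is the inverse of the
smallest. -/
theorem Δ_le_iff (g : G) (c : ℝ) :
    Δ g ≤ c ↔ ∀ t, |θ g t - t| ≤ c ∧ |logStretch g t| ≤ c := by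
  rw [Δ, max_le_iff, max_le_iff, phaseShift, ciSup_le_iff (bddAbove_phaseShift g), forall_and]
  refine and_congr_right fun _ => ⟨fun h t => abs_le.2 ⟨?_, ?_⟩, fun h => ⟨?_, ?_⟩⟩
  · rw [neg_le]
    refine le_trans ?_ h.2
    rw [← Real.exp_le_exp, Real.exp_neg, Real.exp_log (opNorm_pos _), exp_logStretch]
    exact inv_le_of_inv_le₀ (opNorm_pos _) (inv_opNorm_inv_le_norm_planeMap_ray _ t)
  · refine le_trans ?_ h.1
    rw [← Real.exp_le_exp, Real.exp_log (opNorm_pos _), exp_logStretch]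
    exact norm_planeMap_ray_le _ t
  · rw [Real.log_le_iff_le_exp (opNorm_pos _)]
    refine opNorm_le_of_ray fun t => ?_
    rw [← exp_logStretch, Real.exp_le_exp]
    exact (abs_le.1 (h t)).2
  · rw [Real.log_le_iff_le_exp (opNorm_pos _), ← neg_neg c, Real.exp_neg]
    refine opNorm_inv_le_of_ray (Real.exp_pos _) fun t => ?_
    rw [← exp_logStretch, Real.exp_le_exp]
    exact (abs_le.1 (h t)).1

theorem abs_θ_sub_le (g : G) (t : ℝ) : |θ g t - t| ≤ Δ g := ((Δ_le_iff g _).1 le_rfl t).1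

theorem abs_logStretch_le (g : G) (t : ℝ) : |logStretch g t| ≤ Δ g :=
  ((Δ_le_iff g _).1 le_rfl t).2

theorem Δ_one : Δ 1 = 0 := by
  refine le_antisymm ((Δ_le_iff 1 0).2 fun t => ?_) (Δ_nonneg 1)
  simp [logStretch_one]

theorem Δ_mul_le (g h : G) : Δ (g * h) ≤ Δ g + Δ h := by
  refine (Δ_le_iff _ _).2 fun t => ⟨?_, ?_⟩
  · rw [θ_mul_apply, ← sub_add_sub_cancel _ (θ h t)]
    exact (abs_add_le _ _).trans (add_le_add (abs_θ_sub_le _ _) (abs_θ_sub_le _ _))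
  · rw [logStretch_mul, add_comm]
    exact (abs_add_le _ _).trans (add_le_add (abs_logStretch_le _ _) (abs_logStretch_le _ _))

theorem Δ_inv (g : G) : Δ g⁻¹ = Δ g := by
  have key : ∀ g : G, Δ g⁻¹ ≤ Δ g := by
    intro g
    refine (Δ_le_iff _ _).2 fun t => ?_
    obtain ⟨s, rfl⟩ := (θ g).surjective t
    rw [θ_inv_θ, logStretch_inv_θ, abs_neg, abs_sub_comm]
    exact ⟨abs_θ_sub_le g s, abs_logStretch_le g s⟩
  exact (key g).antisymm (by simpa using key g⁻¹)

theorem T_eq_of_planeMap_eq {g h : G}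
    (H : ∀ z, planeMap (T g : GL (Fin 2) ℝ) z = planeMap (T h : GL (Fin 2) ℝ) z) : T g = T h :=
  Subtype.ext (Units.ext ((Matrix.toLin _ _).injective (LinearMap.ext H)))

/-- Substitute `θ g⁻¹ t` for the phase in `Δ_le_iff`. Inverses appear because the action on
stability conditions uses `T_g⁻¹` and `θ_g⁻¹`. -/
theorem Δ_inv_mul_le_iff (g h : G) (c : ℝ) : Δ (h⁻¹ * g) ≤ c ↔
    ∀ t, |θ g⁻¹ t - θ h⁻¹ t| ≤ c ∧ |logStretch g⁻¹ t - logStretch h⁻¹ t| ≤ c := by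
  rw [Δ_le_iff, (θ g⁻¹).surjective.forall]
  refine forall_congr' fun t => ?_
  have hl := logStretch_mul (h⁻¹ * g) g⁻¹ t
  rw [mul_inv_cancel_right] at hl
  rw [← θ_mul_apply, mul_inv_cancel_right, hl, abs_sub_comm, sub_add_cancel_left, abs_neg]

theorem eq_one_of_Δ_eq_zero {g : G} (h : Δ g = 0) : g = 1 := by
  have hθ : ∀ t, θ g t = t := fun t => by
    simpa [h, sub_eq_zero] using abs_θ_sub_le g t
  have hl : ∀ t, logStretch g t = 0 := fun t => by simpa [h] using abs_logStretch_le g t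
  refine ext (T_eq_of_planeMap_eq fun z => ?_) fun t => (hθ t).trans (θ_one_apply t).symm
  obtain ⟨t, ht⟩ := exists_eq_smul_ray z
  rw [ht, map_smul, planeMap_ray, hθ, hl, Real.exp_zero, one_smul, map_one, Subgroup.coe_one,
    planeMap_one, LinearMap.id_apply]

/-- The left-invariant metric on `G` with `dist g 1 = Δ g`. -/
noncomputable abbrev metricSpace : MetricSpace G where
  dist g h := Δ (h⁻¹ * g)
  dist_self g := by rw [inv_mul_cancel, Δ_one]
  dist_comm g h := by rw [← Δ_inv, mul_inv_rev, inv_inv]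
  dist_triangle f g h := by
    have := Δ_mul_le (h⁻¹ * g) (g⁻¹ * f)
    rw [mul_assoc, mul_inv_cancel_left] at this
    linarith
  eq_of_dist_eq_zero h := (inv_mul_eq_one.1 (eq_one_of_Δ_eq_zero h)).symm

end G

/-! ### The metric on an orbit -/

section OrbitMetric

variable {C : Type u} [Category.{v} C] [Preadditive C] [HasZeroObject C]
  [HasShift C ℤ] [∀ n : ℤ, (shiftFunctor C n).Additive] [Pretriangulated C]

namespace StabilityCondition

variable (σ : StabilityCondition C) (c : {c : C // ¬ IsZero c})

theorem mass_act_pos (g : G) : 0 < (σ.act g).mass c := by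
  rw [mass]
  exact Finset.sum_pos (fun j _ => norm_pos_iff.2 (HNFiltration.charge_factor_ne_zero _ j))
    Finset.univ_nonempty

/-- The bound holds factor by factor, since `T_h⁻¹ = T_(h⁻¹ g) T_g⁻¹`. -/
theorem mass_act_le (g h : G) :
    (σ.act h).mass c ≤ Real.exp (h⁻¹ * g).Δ * (σ.act g).mass c := by
  rw [mass_act, mass_act, Finset.mul_sum]
  refine Finset.sum_le_sum fun j _ => ?_
  set z := σ.Z (K₀.cls ((σ.hn c).factor j))
  have hz : planeMap (G.T h : GL (Fin 2) ℝ)⁻¹ z =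
      planeMap (G.T (h⁻¹ * g) : GL (Fin 2) ℝ) (planeMap (G.T g : GL (Fin 2) ℝ)⁻¹ z) := by
    rw [map_mul, map_inv, Subgroup.coe_mul, Subgroup.coe_inv, planeMap_mul_apply,
      planeMap_apply_inv]
  rw [hz]
  refine norm_planeMap_le_of_ray (fun t => ?_) _
  rw [← G.exp_logStretch, Real.exp_le_exp]
  exact (abs_le.1 (G.abs_logStretch_le _ t)).2

theorem abs_log_mass_act_div_le (g h : G) :
    |Real.log ((σ.act g).mass c / (σ.act h).mass c)| ≤ (h⁻¹ * g).Δ := by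
  have hg := σ.mass_act_pos c g
  have hh := σ.mass_act_pos c h
  have key : ∀ g h : G, Real.log ((σ.act h).mass c) ≤ (h⁻¹ * g).Δ + Real.log ((σ.act g).mass c) := by
    intro g h
    have := σ.mass_act_pos c g
    rw [← Real.log_exp (h⁻¹ * g).Δ, ← Real.log_mul (Real.exp_ne_zero _) this.ne']
    exact Real.log_le_log (σ.mass_act_pos c h) (σ.mass_act_le c g h)
  rw [Real.log_div hg.ne' hh.ne', abs_le]
  have h₁ := key g h
  have h₂ := key h g
  rw [← G.Δ_inv, mul_inv_rev, inv_inv] at h₂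
  constructor <;> linarith

theorem log_mass_act_div_of_mem {φ : ℝ} (hc : σ.P φ c.1) (g h : G) :
    Real.log ((σ.act g).mass c / (σ.act h).mass c) =
      G.logStretch g⁻¹ φ - G.logStretch h⁻¹ φ := by
  obtain ⟨r, hr, hz⟩ := σ.charge φ c.1 hc c.2
  have key : ∀ g : G, (σ.act g).mass c = r * Real.exp (G.logStretch g⁻¹ φ) := by
    intro g
    rw [mass_act_of_mem σ c hc, hz]
    change ‖planeMap _ (r * ray φ)‖ = _
    rw [← Complex.real_smul, map_smul, norm_smul, Real.norm_of_nonneg hr.le, G.exp_logStretch,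
      map_inv, Subgroup.coe_inv]
  rw [key, key, mul_div_mul_left _ _ hr.ne', ← Real.exp_sub, Real.log_exp]

end StabilityCondition

namespace Stab

/-- Semistable objects give the inequalities of `G.Δ_inv_mul_le_iff` at their phases, and these are
closed conditions, so density extends them to all `t`. Conversely, a general object only evaluates
the phase maps at its extreme phases, and its mass is a sum of stretched charges. -/
theorem d_act_le_iff (σ : Stab C) (hσ : Dense σ.1.phases) (g h : G) {b : ℝ} (hb : 0 ≤ b) :
    d (σ <• g) (σ <• h) ≤ ENNReal.ofReal b ↔ (h⁻¹ * g).Δ ≤ b := by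
  rw [d, iSup_le_iff]
  simp only [ENNReal.ofReal_le_ofReal_iff hb, max_le_iff]
  change (∀ c, |(σ.1.act g).phaseMin c - (σ.1.act h).phaseMin c| ≤ b ∧
    |(σ.1.act g).phaseMax c - (σ.1.act h).phaseMax c| ≤ b ∧
    |Real.log ((σ.1.act g).mass c / (σ.1.act h).mass c)| ≤ b) ↔ _
  simp only [StabilityCondition.phaseMin_act, StabilityCondition.phaseMax_act, ← G.θ_inv_apply]
  refine ⟨fun H => (G.Δ_inv_mul_le_iff _ _ _).2 fun t => ?_, fun H c => ?_⟩
  · refine hσ.induction (P := fun t => |G.θ g⁻¹ t - G.θ h⁻¹ t| ≤ b ∧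
      |G.logStretch g⁻¹ t - G.logStretch h⁻¹ t| ≤ b) ?_ ?_ t
    · rintro φ ⟨c, h₀, hc⟩
      obtain ⟨-, h₁, h₂⟩ := H ⟨c, h₀⟩
      rw [σ.1.phaseMax_of_mem ⟨c, h₀⟩ hc] at h₁
      rw [σ.1.log_mass_act_div_of_mem ⟨c, h₀⟩ hc] at h₂
      exact ⟨h₁, h₂⟩
    · exact (isClosed_le ((G.continuous_θ _).sub (G.continuous_θ _)).abs continuous_const).inter
        (isClosed_le ((G.continuous_logStretch _).sub (G.continuous_logStretch _)).abs
          continuous_const)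
  · have H' := (G.Δ_inv_mul_le_iff _ _ _).1 H
    exact ⟨(H' _).1, (H' _).1, (σ.1.abs_log_mass_act_div_le c g h).trans H⟩

theorem d_act (σ : Stab C) (hσ : Dense σ.1.phases) (g h : G) :
    d (σ <• g) (σ <• h) = ENNReal.ofReal (h⁻¹ * g).Δ := by
  refine le_antisymm ((d_act_le_iff σ hσ g h (G.Δ_nonneg _)).2 le_rfl) ?_
  rcases eq_or_ne (d (σ <• g) (σ <• h)) ⊤ with hd | hd
  · exact hd ▸ le_top
  · have h' := (d_act_le_iff σ hσ g h ENNReal.toReal_nonneg).1 (ENNReal.ofReal_toReal hd).ge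
    exact ENNReal.ofReal_le_of_le_toReal h'

end Stab

end OrbitMetric

/-! ### Completeness of `G` -/

namespace G

/-- An element of `G` is given by a linear map and a continuous map of the line of phases that
induce the same map on rays. -/
theorem exists_of_continuous (A : ℂ →ₗ[ℝ] ℂ) {ψ : ℝ → ℝ} (hψ : Continuous ψ)
    (hψ₁ : ∀ t, ψ (t + 1) = ψ t + 1) (hA : ∀ t, ∃ r : ℝ, 0 < r ∧ A (ray t) = r • ray (ψ t)) :
    ∃ g : G, (∀ z, planeMap (T g : GL (Fin 2) ℝ) z = A z) ∧ ∀ t, θ g t = ψ t := by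
  have hnat : ∀ (n : ℕ) (t : ℝ), ψ (t + n) = ψ t + n := by
    intro n
    induction n with
    | zero => intro t; simp
    | succ n ih => intro t; push_cast; rw [← add_assoc, hψ₁, ih, add_assoc]
  have hint : ∀ (n : ℤ) (t : ℝ), ψ (t + n) = ψ t + n := by
    intro n t
    obtain ⟨k, rfl | rfl⟩ := n.eq_nat_or_neg
    · exact_mod_cast hnat k t
    · have := hnat k (t + -(k : ℝ))
      rw [neg_add_cancel_right] at this
      push_cast
      linarith
  have hAinj : Function.Injective A := by
    refine (injective_iff_map_eq_zero A).2 fun z hz => ?_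
    obtain ⟨t, ht⟩ := exists_eq_smul_ray z
    obtain ⟨r, hr, h⟩ := hA t
    rw [ht, map_smul, h, smul_smul] at hz
    have := (smul_eq_zero.1 hz).resolve_right (ray_ne_zero _)
    exact norm_eq_zero.1 ((mul_eq_zero.1 this).resolve_right hr.ne')
  -- `A` is injective on rays, so equal values of `ψ` force equality modulo `2`, and `ψ` commutes
  -- with integer translations.
  have hinj : Function.Injective ψ := by
    intro s t hst
    obtain ⟨r, hr, h⟩ := hA s
    obtain ⟨r', hr', h'⟩ := hA t
    have : A (r' • ray s) = A (r • ray t) := by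
      rw [map_smul, map_smul, h, h', hst, smul_comm]
    obtain ⟨n, rfl⟩ := ray_eq_ray_iff.1 (eq_of_smul_ray_eq hr' hr (hAinj this)).2
    have := hint (2 * n) t
    push_cast at this
    linarith
  have hmono : StrictMono ψ := by
    refine (hψ.strictMono_of_inj hinj).resolve_right fun h => ?_
    have := h (lt_add_one (0 : ℝ))
    rw [hψ₁] at this
    linarith
  have hsurj : Function.Surjective ψ := by
    intro y
    have h₁ := hint ⌊y - ψ 0⌋ 0
    have h₂ := hint (⌊y - ψ 0⌋ + 1) 0
    push_cast at h₁ h₂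
    have h₃ := Int.floor_le (y - ψ 0)
    have h₄ := Int.lt_floor_add_one (y - ψ 0)
    exact mem_range_of_exists_le_of_exists_ge hψ ⟨_, by rw [h₁]; linarith⟩ ⟨_, by rw [h₂]; linarith⟩
  have hdet : 0 < (LinearMap.toMatrix Complex.basisOneI Complex.basisOneI A).det := by
    obtain ⟨r, hr, h⟩ := hA 0
    obtain ⟨r', hr', h'⟩ := hA (1 / 2)
    rw [ray_zero] at h
    rw [ray_one_half] at h'
    -- The determinant is `r r' sin (π (ψ (1/2) - ψ 0))`, and monotonicity with `ψ 1 = ψ 0 + 1`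
    -- keeps the angle between `0` and `π`.
    have hsin : 0 < Real.sin (Real.pi * ψ (1 / 2) - Real.pi * ψ 0) := by
      have h₁ := hmono (show (0 : ℝ) < 1 / 2 by norm_num)
      have h₂ := hmono (show (1 / 2 : ℝ) < 0 + 1 by norm_num)
      rw [hψ₁] at h₂
      rw [← mul_sub]
      apply Real.sin_pos_of_pos_of_lt_pi
      · exact mul_pos Real.pi_pos (by linarith)
      · nlinarith [Real.pi_pos]
    rw [Real.sin_sub] at hsin
    rw [Matrix.det_fin_two]
    simp only [LinearMap.toMatrix_apply, Complex.coe_basisOneI, Complex.coe_basisOneI_repr,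
      Matrix.cons_val_zero, Matrix.cons_val_one, h, h', ray_eq, Complex.smul_re, Complex.smul_im,
      Complex.exp_ofReal_mul_I_re, Complex.exp_ofReal_mul_I_im, smul_eq_mul]
    nlinarith [mul_pos (mul_pos hr hr') hsin]
  have hplane : ∀ z, planeMap (Matrix.GeneralLinearGroup.mkOfDetNeZero _ hdet.ne') z = A z := by
    intro z
    simp [planeMap, Matrix.GeneralLinearGroup.mkOfDetNeZero, Matrix.toLin_toMatrix]
  refine ⟨⟨⟨⟨Matrix.GeneralLinearGroup.mkOfDetNeZero _ hdet.ne', hdet⟩,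
    hmono.orderIsoOfSurjective ψ hsurj⟩, hψ₁, fun t => ?_⟩, hplane, fun t => rfl⟩
  rw [hplane]
  exact hA t

theorem logStretch_eq_of_planeMap_ray {g : G} {t l s : ℝ}
    (h : planeMap (T g : GL (Fin 2) ℝ) (ray t) = Real.exp l • ray s) : logStretch g t = l := by
  rw [logStretch, h, norm_smul, norm_ray, mul_one, Real.norm_of_nonneg (Real.exp_pos l).le,
    Real.log_exp]

open Filter Topology in
theorem exists_tendsto_of_cauchy (u : ℕ → ℝ → ℝ)
    (hu : ∀ ε > 0, ∃ N, ∀ m ≥ N, ∀ n ≥ N, ∀ t, |u m t - u n t| ≤ ε) :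
    ∃ f : ℝ → ℝ, (∀ t, Tendsto (fun n => u n t) atTop (𝓝 (f t))) ∧
      ∀ ε > 0, ∃ N, ∀ n ≥ N, ∀ t, |u n t - f t| ≤ ε := by
  have hc : ∀ t, ∃ y, Tendsto (fun n => u n t) atTop (𝓝 y) := by
    refine fun t => cauchySeq_tendsto_of_complete (Metric.cauchySeq_iff.2 fun ε hε => ?_)
    obtain ⟨N, hN⟩ := hu (ε / 2) (half_pos hε)
    exact ⟨N, fun m hm n hn => (hN m hm n hn t).trans_lt (half_lt_self hε)⟩
  choose f hf using hc
  refine ⟨f, hf, fun ε hε => ?_⟩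
  obtain ⟨N, hN⟩ := hu ε hε
  refine ⟨N, fun n hn t => le_of_tendsto (tendsto_const_nhds.sub (hf t)).abs ?_⟩
  filter_upwards [eventually_ge_atTop N] with m hm using hN n hn m hm t

open Filter Topology in
-- A Cauchy sequence has inverses whose phase maps and log-stretches are uniformly Cauchy. The
-- limiting linear map sends each ray to a positive multiple `exp (l t)` of a ray, so it cannot
-- degenerate, and with the limiting phase map it defines the inverse of the limit.
theorem completeSpace : @CompleteSpace G metricSpace.toUniformSpace := by
  let := metricSpace
  refine Metric.complete_of_cauchySeq_tendsto fun u hu => ?_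
  have hu' : ∀ ε > 0, ∃ N, ∀ m ≥ N, ∀ n ≥ N, ∀ t, |θ (u m)⁻¹ t - θ (u n)⁻¹ t| ≤ ε ∧
      |logStretch (u m)⁻¹ t - logStretch (u n)⁻¹ t| ≤ ε := by
    intro ε hε
    obtain ⟨N, hN⟩ := Metric.cauchySeq_iff.1 hu ε hε
    exact ⟨N, fun m hm n hn => (Δ_inv_mul_le_iff _ _ _).1 (hN m hm n hn).le⟩
  obtain ⟨ψ, hψ, hψu⟩ := exists_tendsto_of_cauchy (fun n => θ (u n)⁻¹) fun ε hε =>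
    (hu' ε hε).imp fun N hN m hm n hn t => (hN m hm n hn t).1
  obtain ⟨l, hl, hlu⟩ := exists_tendsto_of_cauchy (fun n => logStretch (u n)⁻¹) fun ε hε =>
    (hu' ε hε).imp fun N hN m hm n hn t => (hN m hm n hn t).2
  have hlim : ∀ t, Tendsto (fun n => planeMap (T (u n)⁻¹ : GL (Fin 2) ℝ) (ray t)) atTop
      (𝓝 (Real.exp (l t) • ray (ψ t))) := by
    intro t
    simp only [planeMap_ray]
    exact ((Real.continuous_exp.tendsto _).comp (hl t)).smul
      ((continuous_ray.tendsto _).comp (hψ t))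
  obtain ⟨A, hA⟩ : ∃ A : ℂ →ₗ[ℝ] ℂ, ∀ z, Tendsto
      (fun n => planeMap (T (u n)⁻¹ : GL (Fin 2) ℝ) z) atTop (𝓝 (A z)) := by
    -- The basis vectors `1` and `I`, of index `i = 0, 1`, are the rays of phase `i / 2`.
    refine ⟨Complex.basisOneI.constr ℝ fun i => Real.exp (l (i / 2)) • ray (ψ (i / 2)),
      fun z => ?_⟩
    have hz : z = z.re • ray 0 + z.im • ray (1 / 2) := by
      rw [ray_zero, ray_one_half]
      simp
    have h := ((hlim 0).const_smul z.re).add ((hlim (1 / 2)).const_smul z.im)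
    simp only [← map_smul, ← map_add, ← hz] at h
    simpa [Module.Basis.constr_apply_fintype] using h
  have hAψ : ∀ t, A (ray t) = Real.exp (l t) • ray (ψ t) :=
    fun t => tendsto_nhds_unique (hA _) (hlim t)
  have hcont : Continuous ψ := by
    refine TendstoUniformly.continuous (F := fun n => θ (u n)⁻¹) (p := atTop) ?_
      (Frequently.of_forall fun n => continuous_θ _)
    refine Metric.tendstoUniformly_iff.2 fun ε hε => ?_
    obtain ⟨N, hN⟩ := hψu (ε / 2) (half_pos hε)
    filter_upwards [eventually_ge_atTop N] with n hn t
    rw [dist_comm]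
    exact (hN n hn t).trans_lt (half_lt_self hε)
  obtain ⟨g, hgT, hgθ⟩ := exists_of_continuous A hcont
    (fun t => tendsto_nhds_unique (hψ (t + 1)) (by simpa only [θ_add_one] using (hψ t).add_const 1))
    fun t => ⟨_, Real.exp_pos _, hAψ t⟩
  have hgl : ∀ t, logStretch g t = l t := fun t =>
    logStretch_eq_of_planeMap_ray ((hgT _).trans (hAψ t))
  refine ⟨g⁻¹, Metric.tendsto_atTop.2 fun ε hε => ?_⟩
  obtain ⟨N, hN⟩ := hψu (ε / 2) (half_pos hε)
  obtain ⟨N', hN'⟩ := hlu (ε / 2) (half_pos hε)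
  refine ⟨max N N', fun n hn => lt_of_le_of_lt ?_ (half_lt_self hε)⟩
  refine (Δ_inv_mul_le_iff _ _ _).2 fun t => ?_
  rw [inv_inv, hgθ, hgl]
  exact ⟨hN n (le_of_max_le_left hn) t, hN' n (le_of_max_le_right hn) t⟩

end G

/-! ### Hyperbolic distance and the coefficients of a linear map -/

open ComplexConjugate

open UpperHalfPlane in
-- The distance is a function of `|z - w|² / (im z * im w)`, whose numerator and denominator are
-- both multiplied by `det² / |denom z * denom w|²`.
theorem dist_smul_smul_of_det_pos {g : GL (Fin 2) ℝ} (hg : 0 < g.det.val) (z w : ℍ) :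
    dist (g • z) (g • w) = dist z w := by
  refine Real.cosh_strictMonoOn.injOn dist_nonneg dist_nonneg ?_
  have hz := denom_ne_zero g z
  have hw := denom_ne_zero g w
  have hdet : (g.det.val : ℂ) = g 0 0 * g 1 1 - g 0 1 * g 1 0 := by
    rw [Matrix.GeneralLinearGroup.val_det_apply, Matrix.det_fin_two]
    push_cast
    rfl
  have hsub : num g z / denom g z - num g w / denom g w =
      g.det.val * (z - w) / (denom g z * denom g w) := by
    rw [div_sub_div _ _ hz hw, hdet]
    congr 1
    simp only [num, denom]
    ring
  rw [cosh_dist, cosh_dist, dist_eq_norm, dist_eq_norm, im_smul_eq_div_normSq,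
    im_smul_eq_div_normSq, coe_smul_of_det_pos hg, coe_smul_of_det_pos hg, hsub, norm_div, norm_mul,
    norm_mul, Complex.norm_real, Real.norm_of_nonneg hg.le, abs_of_pos hg,
    Complex.normSq_eq_norm_sq, Complex.normSq_eq_norm_sq]
  have h₁ := norm_pos_iff.2 hz
  have h₂ := norm_pos_iff.2 hw
  have h₃ := z.im_pos
  have h₄ := w.im_pos
  field_simp

section Coefficients

variable (T : GL (Fin 2) ℝ)

/-- The coefficient `α` of a linear map `z ↦ α z + β conj z`. -/
noncomputable def linearCoeff : ℂ := (planeMap T 1 - Complex.I * planeMap T Complex.I) / 2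

/-- The coefficient `β` of a linear map `z ↦ α z + β conj z`. -/
noncomputable def antilinearCoeff : ℂ := (planeMap T 1 + Complex.I * planeMap T Complex.I) / 2

theorem planeMap_eq (z : ℂ) :
    planeMap T z = linearCoeff T * z + antilinearCoeff T * conj z := by
  have hz : planeMap T z = z.re * planeMap T 1 + z.im * planeMap T Complex.I := by
    rw [← Complex.real_smul, ← Complex.real_smul, ← map_smul, ← map_smul, ← map_add]
    simp
  have hc : conj z = z.re - z.im * Complex.I := by
    apply Complex.ext <;> simp
  rw [hz, hc]
  conv_rhs => enter [1, 2]; rw [← Complex.re_add_im z]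
  rw [linearCoeff, antilinearCoeff]
  linear_combination (z.im * planeMap T Complex.I) * Complex.I_sq

theorem planeMap_one_apply : planeMap T 1 = T 0 0 + T 1 0 * Complex.I := by
  simp [planeMap, Matrix.toLin_apply, Matrix.mulVec, Complex.basisOneI, dotProduct]

theorem planeMap_I_apply : planeMap T Complex.I = T 0 1 + T 1 1 * Complex.I := by
  simp [planeMap, Matrix.toLin_apply, Matrix.mulVec, Complex.basisOneI, dotProduct]

theorem sq_norm_coeff_sub : ‖linearCoeff T‖ ^ 2 - ‖antilinearCoeff T‖ ^ 2 = T.det.val := by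
  rw [Matrix.GeneralLinearGroup.val_det_apply, Matrix.det_fin_two, Complex.sq_norm,
    Complex.sq_norm, linearCoeff, antilinearCoeff, planeMap_one_apply, planeMap_I_apply]
  simp [Complex.normSq_apply]
  ring

variable {T}

theorem norm_antilinearCoeff_lt (hT : 0 < T.det.val) :
    ‖antilinearCoeff T‖ < ‖linearCoeff T‖ := by
  refine lt_of_pow_lt_pow_left₀ 2 (norm_nonneg _) ?_
  linarith [sq_norm_coeff_sub T]

open UpperHalfPlane in
-- Here `tanh (dist z i / 2) = |z - i| / |z + i|`; for `z = T • i`, clearing the common denominator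
-- turns the two differences into `2 i conj β` and `2 i α`.
theorem tanh_half_dist_smul_I (hT : 0 < T.det.val) :
    Real.tanh (dist (T • I) I / 2) = ‖antilinearCoeff T‖ / ‖linearCoeff T‖ := by
  have hden : (T 1 0 * Complex.I + T 1 1 : ℂ) ≠ 0 := denom_ne_zero T I
  have h₁ : ((T 0 0 * Complex.I + T 0 1) / (T 1 0 * Complex.I + T 1 1) - Complex.I : ℂ) =
      2 * Complex.I * conj (antilinearCoeff T) / (T 1 0 * Complex.I + T 1 1) := by
    rw [eq_div_iff hden, sub_mul, div_mul_cancel₀ _ hden, antilinearCoeff, planeMap_one_apply,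
      planeMap_I_apply]
    simp only [map_div₀, map_add, map_mul, Complex.conj_I, Complex.conj_ofReal, map_ofNat]
    linear_combination (T 0 1 - T 1 1 * Complex.I : ℂ) * Complex.I_sq
  have h₂ : ((T 0 0 * Complex.I + T 0 1) / (T 1 0 * Complex.I + T 1 1) - -Complex.I : ℂ) =
      2 * Complex.I * linearCoeff T / (T 1 0 * Complex.I + T 1 1) := by
    rw [eq_div_iff hden, sub_mul, div_mul_cancel₀ _ hden, linearCoeff, planeMap_one_apply,
      planeMap_I_apply]
    linear_combination (T 0 1 + T 1 1 * Complex.I : ℂ) * Complex.I_sq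
  rw [tanh_half_dist, coe_smul_of_det_pos hT, coe_I, Complex.conj_I, num, denom, dist_eq_norm,
    dist_eq_norm, h₁, h₂]
  simp only [norm_div, norm_mul, Complex.norm_I, Complex.norm_conj, Complex.norm_ofNat, mul_one]
  have := norm_pos_iff.2 hden
  field_simp

theorem conj_ray (t : ℝ) : conj (ray t) = ray (-t) := by
  rw [ray_eq, ray_eq, ← Complex.exp_conj]
  simp

theorem ray_add_one (t : ℝ) : ray (t + 1) = -ray t := by
  rw [ray_add, ray_eq 1]
  simp

variable (T) in
theorem exists_norm_planeMap_ray_eq_add :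
    ∃ t, ‖planeMap T (ray t)‖ = ‖linearCoeff T‖ + ‖antilinearCoeff T‖ := by
  obtain ⟨p, hp⟩ := exists_eq_smul_ray (linearCoeff T)
  obtain ⟨q, hq⟩ := exists_eq_smul_ray (antilinearCoeff T)
  -- With `p` and `q` the phases of `α` and `β`, this ray makes `α z` and `β conj z` point in the
  -- same direction.
  have : planeMap T (ray ((q - p) / 2)) =
      (‖linearCoeff T‖ + ‖antilinearCoeff T‖) • ray ((p + q) / 2) := by
    conv_lhs => rw [planeMap_eq, conj_ray, hp, hq]
    rw [smul_mul_assoc, smul_mul_assoc, ← ray_add, ← ray_add, add_smul]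
    ring_nf
  exact ⟨_, by rw [this, norm_smul, norm_ray, mul_one, Real.norm_of_nonneg (by positivity)]⟩

theorem exists_norm_planeMap_ray_eq_sub (hT : 0 < T.det.val) :
    ∃ t, ‖planeMap T (ray t)‖ = ‖linearCoeff T‖ - ‖antilinearCoeff T‖ := by
  obtain ⟨p, hp⟩ := exists_eq_smul_ray (linearCoeff T)
  obtain ⟨q, hq⟩ := exists_eq_smul_ray (antilinearCoeff T)
  -- Now the two terms point in opposite directions: their phases differ by `1`.
  have : planeMap T (ray ((q + 1 - p) / 2)) =
      (‖linearCoeff T‖ - ‖antilinearCoeff T‖) • ray ((p + q - 1) / 2 + 1) := by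
    conv_lhs => rw [planeMap_eq, conj_ray, hp, hq]
    rw [smul_mul_assoc, smul_mul_assoc, ← ray_add, ← ray_add, sub_smul]
    conv_rhs => rw [ray_add_one, sub_eq_add_neg, ← smul_neg, neg_neg, ← ray_add_one]
    ring_nf
  exact ⟨_, by rw [this, norm_smul, norm_ray, mul_one, Real.norm_of_nonneg
    (sub_pos.2 (norm_antilinearCoeff_lt hT)).le]⟩

end Coefficients

/-- Seen from the origin, the disc of radius `‖u‖` around `1` has half-angle of sine `‖u‖`; Jordan's
inequality `2 x / π ≤ sin x` turns this into a bound on the angle. -/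
theorem abs_arg_one_add_le {u : ℂ} (hu : ‖u‖ < 1) : |(1 + u).arg| ≤ Real.pi / 2 * ‖u‖ := by
  have hre : 0 < (1 + u).re := by
    have := neg_le_of_abs_le (Complex.abs_re_le_norm u)
    simp only [Complex.add_re, Complex.one_re]
    linarith
  have h := Real.mul_le_sin (abs_nonneg (1 + u).arg) (Complex.abs_arg_le_pi_div_two_iff.2 hre.le)
  have hpos : 0 < ‖1 + u‖ := norm_pos_iff.2 fun h => by simp [h] at hre
  have hsin : Real.sin |(1 + u).arg| ≤ ‖u‖ := by
    have : Real.sin |(1 + u).arg| ≤ |Real.sin (1 + u).arg| := by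
      rcases abs_cases (1 + u).arg with ⟨h, -⟩ | ⟨h, -⟩
      · rw [h]
        exact le_abs_self _
      · rw [h, Real.sin_neg]
        exact neg_le_abs _
    refine this.trans ?_
    rw [Complex.sin_arg, abs_div, abs_norm, div_le_iff₀ hpos]
    refine abs_le_of_sq_le_sq ?_ (by positivity)
    rw [mul_pow, Complex.sq_norm, Complex.sq_norm, Complex.normSq_apply, Complex.normSq_apply]
    simp only [Complex.add_re, Complex.add_im, Complex.one_re, Complex.one_im]
    -- The difference `|u|² |1 + u|² - (im u)²` is the square of `|u|² + re u`.
    nlinarith [sq_nonneg (u.re * u.re + u.im * u.im + u.re)]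
  have := h.trans hsin
  rwa [div_mul_eq_mul_div, div_le_iff₀ Real.pi_pos, mul_comm, ← le_div_iff₀ two_pos,
    mul_div_assoc, mul_comm] at this

theorem exp_eq_cosh_mul_one_add_tanh (x : ℝ) : Real.exp x = Real.cosh x * (1 + Real.tanh x) := by
  rw [mul_add, mul_one, Real.tanh_eq_sinh_div_cosh, mul_div_cancel₀ _ (Real.cosh_pos x).ne',
    Real.cosh_add_sinh]

theorem exp_neg_eq_cosh_mul_one_sub_tanh (x : ℝ) :
    Real.exp (-x) = Real.cosh x * (1 - Real.tanh x) := by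
  rw [mul_sub, mul_one, Real.tanh_eq_sinh_div_cosh, mul_div_cancel₀ _ (Real.cosh_pos x).ne',
    Real.cosh_sub_sinh]

/-- This crude bound, from `exp (-2x) ≥ 1 - 2x`, suffices because the phase shift in `G.exists_Δ_le`
is at most `tanh x / 2`. -/
theorem tanh_le_two_mul {x : ℝ} (hx : 0 ≤ x) : Real.tanh x ≤ 2 * x := by
  have h : Real.exp (-(2 * x)) * (1 + Real.tanh x) = 1 - Real.tanh x := by
    have := Real.cosh_pos x
    refine mul_left_cancel₀ this.ne' ?_
    rw [mul_left_comm, ← exp_eq_cosh_mul_one_add_tanh, ← exp_neg_eq_cosh_mul_one_sub_tanh,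
      ← Real.exp_add]
    ring_nf
  have h₁ := Real.add_one_le_exp (-(2 * x))
  have h₂ := Real.tanh_lt_one x
  have h₃ := Real.neg_one_lt_tanh x
  nlinarith

/-! ### Comparing `Δ` with the distance from `i`, modulo `ℂ` -/

namespace G

/-- The extreme log-stretches differ by exactly `dist (T_g • i) i`, while both lie in `[-Δ g, Δ g]`.
-/
theorem half_dist_smul_I_le_Δ (g : G) :
    dist (g.T.1 • UpperHalfPlane.I) UpperHalfPlane.I / 2 ≤ Δ g := by
  have hT : 0 < (g.T.1).det.val := g.T.2
  obtain ⟨s, hs⟩ := exists_norm_planeMap_ray_eq_add g.T.1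
  obtain ⟨t, ht⟩ := exists_norm_planeMap_ray_eq_sub hT
  have hα := (norm_nonneg _).trans_lt (norm_antilinearCoeff_lt hT)
  set x := dist (g.T.1 • UpperHalfPlane.I) UpperHalfPlane.I / 2 with hx
  have htanh : ‖linearCoeff g.T.1‖ * Real.tanh x = ‖antilinearCoeff g.T.1‖ := by
    rw [hx, tanh_half_dist_smul_I hT, mul_div_cancel₀ _ hα.ne']
  have key : Real.exp (logStretch g s) * Real.exp (-x) = Real.exp (logStretch g t) * Real.exp x := by
    rw [exp_logStretch, exp_logStretch, hs, ht, exp_neg_eq_cosh_mul_one_sub_tanh,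
      exp_eq_cosh_mul_one_add_tanh, ← htanh]
    ring
  rw [← Real.exp_add, ← Real.exp_add, Real.exp_eq_exp] at key
  have h₁ := (abs_le.1 (abs_logStretch_le g s)).2
  have h₂ := (abs_le.1 (abs_logStretch_le g t)).1
  linarith

theorem planeMap_ofComplex (z w : ℂ) : planeMap (T (ofComplex z) : GL (Fin 2) ℝ) w =
    Complex.exp (Complex.I * Real.pi * z) * w := by
  change Matrix.toLin Complex.basisOneI Complex.basisOneI
    (Algebra.leftMulMatrix Complex.basisOneI _) w = _
  rw [Algebra.leftMulMatrix_apply, Matrix.toLin_toMatrix]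
  rfl

theorem θ_ofComplex (z : ℂ) (t : ℝ) : θ (ofComplex z) t = t + z.re := rfl

theorem antilinearCoeff_ofComplex (z : ℂ) :
    antilinearCoeff (T (ofComplex z) : GL (Fin 2) ℝ) = 0 := by
  rw [antilinearCoeff, planeMap_ofComplex, planeMap_ofComplex]
  linear_combination Complex.exp (Complex.I * Real.pi * z) / 2 * Complex.I_sq

theorem ofComplex_smul_I (z : ℂ) : (ofComplex z).T.1 • UpperHalfPlane.I = UpperHalfPlane.I := by
  have h := tanh_half_dist_smul_I (T := (ofComplex z).T.1) (ofComplex z).T.2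
  rw [antilinearCoeff_ofComplex, norm_zero, zero_div, Real.tanh_eq_sinh_div_cosh,
    div_eq_zero_iff] at h
  have := Real.sinh_eq_zero.1 (h.resolve_right (Real.cosh_pos _).ne')
  exact dist_eq_zero.1 (by linarith)

/-- The ray of phase `t` is multiplied by `cosh x * (1 + μ ray (-2t))`. Its modulus lies between
`cosh x * (1 - tanh x) = exp (-x)` and `cosh x * (1 + tanh x) = exp x`. As `‖μ‖ < 1`, the principal
argument is continuous there, so it gives a lift to `G`, with phase shift at most `tanh x / 2 ≤ x`.
-/
theorem exists_Δ_le {x : ℝ} (hx : 0 ≤ x) {μ : ℂ} (hμ : ‖μ‖ = Real.tanh x) :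
    ∃ g : G, (∀ z, planeMap (T g : GL (Fin 2) ℝ) z = Real.cosh x * (z + μ * conj z)) ∧ Δ g ≤ x := by
  have hu : ∀ t, ‖μ * ray (-(2 * t))‖ = Real.tanh x := fun t => by
    rw [norm_mul, norm_ray, mul_one, hμ]
  have hu₁ : ∀ t, ‖μ * ray (-(2 * t))‖ < 1 := fun t => (hu t).trans_lt (Real.tanh_lt_one x)
  have hslit : ∀ t, 1 + μ * ray (-(2 * t)) ∈ Complex.slitPlane := fun t =>
    Complex.mem_slitPlane_of_norm_lt_one (hu₁ t)
  set A : ℂ →ₗ[ℝ] ℂ := Real.cosh x • (LinearMap.id + LinearMap.mulLeft ℝ μ ∘ₗ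
    Complex.conjAe.toLinearMap) with hA
  have hAz : ∀ z, A z = Real.cosh x * (z + μ * conj z) := fun z => by
    simp [hA, mul_add]
  set ψ : ℝ → ℝ := fun t => t + (1 + μ * ray (-(2 * t))).arg / Real.pi with hψ
  have hAψ : ∀ t, A (ray t) = (Real.cosh x * ‖1 + μ * ray (-(2 * t))‖) • ray (ψ t) := by
    intro t
    have h₁ : ray t + μ * ray (-t) = ray t * (1 + μ * ray (-(2 * t))) := by
      rw [mul_add, mul_one, mul_left_comm, ← ray_add]
      ring_nf
    rw [hAz, conj_ray, h₁, mul_smul, Complex.real_smul, Complex.real_smul, hψ]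
    dsimp only
    rw [ray_add, ray_eq (_ / _), mul_div_cancel₀ _ Real.pi_ne_zero, mul_left_comm (‖_‖ : ℂ),
      Complex.norm_mul_exp_arg_mul_I]
  have hpos : ∀ t, 0 < Real.cosh x * ‖1 + μ * ray (-(2 * t))‖ := fun t =>
    mul_pos (Real.cosh_pos x) (norm_pos_iff.2 (Complex.slitPlane_ne_zero (hslit t)))
  have hcont : Continuous ψ := by
    refine continuous_id.add (Continuous.div_const ?_ _)
    refine continuous_iff_continuousAt.2 fun t => ContinuousAt.comp (g := Complex.arg)
      (f := fun t => 1 + μ * ray (-(2 * t))) (Complex.continuousAt_arg (hslit t)) ?_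
    exact (continuous_const.add (continuous_const.mul
      (continuous_ray.comp (by fun_prop)))).continuousAt
  obtain ⟨g, hgT, hgθ⟩ := exists_of_continuous A hcont (fun t => by
    have : ray (-(2 * (t + 1))) = ray (-(2 * t)) :=
      ray_eq_ray_iff.2 ⟨-1, by push_cast; ring⟩
    simp only [hψ, this]
    ring) fun t => ⟨_, hpos t, hAψ t⟩
  refine ⟨g, fun z => (hgT z).trans (hAz z), (Δ_le_iff _ _).2 fun t => ⟨?_, ?_⟩⟩
  · rw [hgθ, hψ]
    dsimp only
    rw [add_sub_cancel_left, abs_div, abs_of_pos Real.pi_pos, div_le_iff₀ Real.pi_pos]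
    refine (abs_arg_one_add_le (hu₁ t)).trans ?_
    rw [hu]
    nlinarith [tanh_le_two_mul hx, Real.pi_pos]
  · have h₁ : Real.exp (logStretch g t) = Real.cosh x * ‖1 + μ * ray (-(2 * t))‖ := by
      rw [exp_logStretch, hgT, hAψ, norm_smul, norm_ray, mul_one, Real.norm_of_nonneg (hpos t).le]
    have h₂ := norm_add_le 1 (μ * ray (-(2 * t)))
    have h₃ := norm_sub_norm_le 1 (-(μ * ray (-(2 * t))))
    rw [norm_neg, sub_neg_eq_add] at h₃
    rw [norm_one, hu] at h₂ h₃
    refine abs_le.2 ⟨?_, ?_⟩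
    · rw [← Real.exp_le_exp, h₁, exp_neg_eq_cosh_mul_one_sub_tanh]
      exact mul_le_mul_of_nonneg_left h₃ (Real.cosh_pos x).le
    · rw [← Real.exp_le_exp, h₁, exp_eq_cosh_mul_one_add_tanh]
      exact mul_le_mul_of_nonneg_left h₂ (Real.cosh_pos x).le

theorem exists_T_eq (S : GL(2, ℝ)⁺) : ∃ (z : ℂ) (g : G), T (ofComplex z * g) = S ∧
    Δ g ≤ dist (S.1 • UpperHalfPlane.I) UpperHalfPlane.I / 2 := by
  have hS : 0 < (S.1).det.val := S.2
  have hα := norm_pos_iff.1 ((norm_nonneg _).trans_lt (norm_antilinearCoeff_lt hS))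
  set x := dist (S.1 • UpperHalfPlane.I) UpperHalfPlane.I / 2 with hx
  obtain ⟨g, hg, hΔ⟩ := exists_Δ_le (μ := antilinearCoeff S.1 / linearCoeff S.1)
    (x := x) (by positivity) (by rw [norm_div, hx, tanh_half_dist_smul_I hS])
  have hc : (Real.cosh x : ℂ) ≠ 0 := by exact_mod_cast (Real.cosh_pos x).ne'
  have hπ : Complex.I * Real.pi ≠ 0 :=
    mul_ne_zero Complex.I_ne_zero (by exact_mod_cast Real.pi_ne_zero)
  -- `S z = (α / cosh x) * cosh x * (z + (β / α) conj z)`; the logarithm writes the first factor as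
  -- `exp (iπ z)`.
  refine ⟨Complex.log (linearCoeff S.1 / Real.cosh x) / (Complex.I * Real.pi), g, ?_, hΔ⟩
  refine Subtype.ext (Units.ext ((Matrix.toLin Complex.basisOneI Complex.basisOneI).injective
    (LinearMap.ext fun z => ?_)))
  change planeMap (T (_ * g) : GL (Fin 2) ℝ) z = planeMap S.1 z
  rw [map_mul, Subgroup.coe_mul, planeMap_mul_apply, hg, planeMap_ofComplex, mul_div_cancel₀ _ hπ,
    Complex.exp_log (div_ne_zero hα hc), planeMap_eq]
  field_simp

/-- Two lifts of one matrix have phase maps differing by an even integer at each `t`, and by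
continuity this integer is constant. Translation by an even integer comes from `ℂ`. -/
theorem eq_ofComplex_mul_of_T_eq {g h : G} (hT : T g = T h) :
    ∃ z : ℂ, g = ofComplex z * h := by
  have hn : ∀ t, ∃ n : ℤ, θ g t = θ h t + 2 * n := by
    intro t
    have := planeMap_ray g t
    rw [hT, planeMap_ray h] at this
    exact ray_eq_ray_iff.1 (eq_of_smul_ray_eq (Real.exp_pos _) (Real.exp_pos _) this).2.symm
  choose n hn using hn
  have hc : Continuous n := by
    rw [Int.isClosedEmbedding_coe_real.isEmbedding.continuous_iff]
    have : (Int.cast ∘ n : ℝ → ℝ) = fun t => (θ g t - θ h t) / 2 := by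
      funext t
      simp [hn t]
    rw [this]
    exact ((continuous_θ g).sub (continuous_θ h)).div_const 2
  have hconst : ∀ t, n t = n 0 := fun t => PreconnectedSpace.constant inferInstance hc
  refine ⟨2 * n 0, ext (T_eq_of_planeMap_eq fun z => ?_) fun t => ?_⟩
  · rw [map_mul, Subgroup.coe_mul, planeMap_mul_apply, planeMap_ofComplex, hT]
    rw [show Complex.I * Real.pi * (2 * n 0) = n 0 * (2 * Real.pi * Complex.I) by ring,
      Complex.exp_int_mul_two_pi_mul_I, one_mul]
  · rw [θ_mul_apply, θ_ofComplex, hn, hconst]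
    simp

theorem exists_Δ_ofComplex_inv_mul_le (g : G) : ∃ z : ℂ, Δ ((ofComplex z)⁻¹ * g) ≤
    dist (g.T.1 • UpperHalfPlane.I) UpperHalfPlane.I / 2 := by
  obtain ⟨z, h, hT, hΔ⟩ := exists_T_eq g.T
  obtain ⟨w, hw⟩ := eq_ofComplex_mul_of_T_eq hT.symm
  refine ⟨w + z, ?_⟩
  have : (ofComplex (w + z))⁻¹ * g = h := by
    rw [hw, ofComplex_add, ← mul_assoc (ofComplex w), inv_mul_cancel_left]
  rwa [this]

end G

/-! ### Freeness, the quotient by `ℂ` and its metric -/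

namespace Stab

variable {C : Type u} [Category.{v} C] [Preadditive C] [HasZeroObject C]
  [HasShift C ℤ] [∀ n : ℤ, (shiftFunctor C n).Additive] [Pretriangulated C]

theorem d_self (σ : Stab C) : d σ σ = 0 := by
  simp [d]

theorem act_injective {σ : Stab C} (hσ : Dense σ.1.phases) {g h : G} (H : σ <• g = σ <• h) :
    g = h := by
  have hd := d_act σ hσ g h
  rw [H, d_self, eq_comm, ENNReal.ofReal_eq_zero] at hd
  exact (inv_mul_eq_one.1 (G.eq_one_of_Δ_eq_zero (hd.antisymm (G.Δ_nonneg _)))).symm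

theorem quotDist_act {σ : Stab C} (hσ : Dense σ.1.phases) (g h : G) :
    quotDist (σ <• g) (σ <• h) = ENNReal.ofReal
      (dist (g.T.1 • UpperHalfPlane.I) (h.T.1 • UpperHalfPlane.I) / 2) := by
  have hdist : ∀ z, dist (((G.ofComplex z)⁻¹ * (h⁻¹ * g)).T.1 • UpperHalfPlane.I)
      UpperHalfPlane.I = dist (g.T.1 • UpperHalfPlane.I) (h.T.1 • UpperHalfPlane.I) := by
    intro z
    -- Apply the isometry `T_(h z)`; it sends `i` to `T_h • i` because `ℂ` fixes `i`.
    rw [← dist_smul_smul_of_det_pos (h * G.ofComplex z).T.2, smul_smul, ← Subgroup.coe_mul,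
      ← map_mul, show h * G.ofComplex z * ((G.ofComplex z)⁻¹ * (h⁻¹ * g)) = g by group,
      map_mul G.T h, Subgroup.coe_mul, mul_smul, G.ofComplex_smul_I]
  have hd : ∀ z, d (σ <• g) ((σ <• h) <• G.ofComplex z) =
      ENNReal.ofReal ((G.ofComplex z)⁻¹ * (h⁻¹ * g)).Δ := by
    intro z
    rw [op_smul_op_smul, d_act σ hσ, mul_inv_rev, mul_assoc]
  simp only [quotDist, hd]
  refine le_antisymm ?_ (le_iInf fun z => ENNReal.ofReal_le_ofReal ?_)
  · obtain ⟨z, hz⟩ := G.exists_Δ_ofComplex_inv_mul_le (h⁻¹ * g)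
    refine iInf_le_of_le z (ENNReal.ofReal_le_ofReal (hz.trans_eq ?_))
    rw [← hdist 0, G.ofComplex_zero, inv_one, one_mul]
  · rw [← hdist z]
    exact G.half_dist_smul_I_le_Δ _

theorem Orbit.mk_surjective (σ : Stab C) : Function.Surjective (Orbit.mk σ) := by
  rintro ⟨_, g, rfl⟩
  exact ⟨g.unop, rfl⟩

theorem complexSetoid_mk_iff {σ : Stab C} (hσ : Dense σ.1.phases) (g h : G) :
    (complexSetoid σ).r (Orbit.mk σ g) (Orbit.mk σ h) ↔
      g.T.1 • UpperHalfPlane.I = h.T.1 • UpperHalfPlane.I := by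
  have hr : (complexSetoid σ).r (Orbit.mk σ g) (Orbit.mk σ h) ↔
      ∃ z, σ <• h = (σ <• g) <• G.ofComplex z := Iff.rfl
  rw [hr]
  constructor
  · rintro ⟨z, hz⟩
    rw [op_smul_op_smul] at hz
    rw [act_injective hσ hz, map_mul, Subgroup.coe_mul, mul_smul, G.ofComplex_smul_I]
  · intro H
    -- If `g⁻¹ h` fixes `i`, the optimal element of `ℂ` is at `Δ`-distance zero from `g⁻¹ h`, hence
    -- equal to it: the stabiliser of `i` is `ℂ`.
    obtain ⟨z, hz⟩ := G.exists_Δ_ofComplex_inv_mul_le (g⁻¹ * h)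
    have hI : (g⁻¹ * h).T.1 • UpperHalfPlane.I = UpperHalfPlane.I := by
      rw [map_mul, Subgroup.coe_mul, mul_smul, ← H, smul_smul, ← Subgroup.coe_mul, ← map_mul,
        inv_mul_cancel, map_one, Subgroup.coe_one, one_smul]
    rw [hI, dist_self, zero_div] at hz
    have h₁ := inv_mul_eq_one.1 (G.eq_one_of_Δ_eq_zero (hz.antisymm (G.Δ_nonneg _)))
    exact ⟨z, by rw [op_smul_op_smul, h₁, mul_inv_cancel_left]⟩

theorem exists_smul_I_eq (τ : ℍ) : ∃ g : G, g.T.1 • UpperHalfPlane.I = τ := by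
  obtain ⟨z, g, h, -⟩ := G.exists_T_eq ⟨Matrix.SpecialLinearGroup.toGL τ.toSL2R, by
    rw [Matrix.mem_glpos]
    simp⟩
  refine ⟨_, (congrArg (fun S : GL(2, ℝ)⁺ => S.1 • UpperHalfPlane.I) h).trans ?_⟩
  exact UpperHalfPlane.toSL2R_smul_I τ

/-- The bijection `σG/ℂ ≃ ℍ` induced by `σ g ↦ T_g • i`. -/
theorem exists_equiv {σ : Stab C} (hσ : Dense σ.1.phases) :
    ∃ Φ : Quotient (complexSetoid σ) ≃ ℍ, ∀ g : G,
      Φ (Quotient.mk _ (Orbit.mk σ g)) = g.T.1 • UpperHalfPlane.I := by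
  choose s hs using Orbit.mk_surjective σ
  let F : Quotient (complexSetoid σ) → ℍ := Quotient.lift (fun x => (s x).T.1 • UpperHalfPlane.I)
    fun x y hxy => (complexSetoid_mk_iff hσ _ _).1 (by rw [hs, hs]; exact hxy)
  have hF : ∀ g : G, F (Quotient.mk _ (Orbit.mk σ g)) = g.T.1 • UpperHalfPlane.I := by
    intro g
    refine (complexSetoid_mk_iff hσ _ _).1 ?_
    rw [hs]
  refine ⟨Equiv.ofBijective F ⟨?_, fun τ => ?_⟩, hF⟩
  · rintro ⟨x⟩ ⟨y⟩ hxy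
    obtain ⟨g, rfl⟩ := Orbit.mk_surjective σ x
    obtain ⟨h, rfl⟩ := Orbit.mk_surjective σ y
    exact Quotient.sound ((complexSetoid_mk_iff hσ g h).2 (((hF g).symm.trans hxy).trans (hF h)))
  · obtain ⟨g, hg⟩ := exists_smul_I_eq τ
    exact ⟨_, (hF g).trans hg⟩

end Stab

end Stability

/-- If the phases of the `σ`-semistable objects are dense, the orbit `σG` is free, `d` restricts on
it to the metric `d_G (g, h) = Δ (h⁻¹ g)` of `G`, which does not depend on `σ` and is
left-invariant and complete, and the quotient metric on `σG/ℂ ≅ ℍ` is half the hyperbolic one. -/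
theorem proposition4p1 {C : Type u} [Category.{v} C] [Preadditive C] [HasZeroObject C]
    [HasShift C ℤ] [∀ n : ℤ, (shiftFunctor C n).Additive] [Pretriangulated C] [IsTriangulated C]
    (σ : Stability.Stab C) (hσ : Dense σ.1.phases) :
    (∀ τ ∈ MulAction.orbit Stability.Gᵐᵒᵖ σ, ∀ g : Stability.G, τ <• g = τ → g = 1) ∧
    (∃ m : MetricSpace Stability.G,
      (∀ g h : Stability.G, dist g h = (h⁻¹ * g).Δ) ∧
      (∀ g h : Stability.G, Stability.Stab.d (σ <• g) (σ <• h) = ENNReal.ofReal (dist g h)) ∧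
      (∀ f g h : Stability.G, dist (f * g) (f * h) = dist g h) ∧
      CompleteSpace Stability.G) ∧
    (∃ Φ : Quotient (Stability.Stab.complexSetoid σ) ≃ ℍ,
      (∀ g : Stability.G, Φ (Quotient.mk _ (Stability.Stab.Orbit.mk σ g)) =
        g.T.1 • UpperHalfPlane.I) ∧
      ∀ x y : Stability.Stab.Orbit σ, Stability.Stab.quotDist x.1 y.1 =
        ENNReal.ofReal (dist (Φ (Quotient.mk _ x)) (Φ (Quotient.mk _ y)) / 2)) := by
  refine ⟨?_, ⟨Stability.G.metricSpace, fun _ _ => rfl, Stability.Stab.d_act σ hσ, ?_,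
    Stability.G.completeSpace⟩, ?_⟩
  · rintro _ ⟨f, rfl⟩ g hg
    have h : σ <• (f.unop * g) = σ <• f.unop := by
      rw [op_smul_mul]
      exact hg
    exact mul_eq_left.1 (Stability.Stab.act_injective hσ h)
  · intro f g h
    change Stability.G.Δ _ = Stability.G.Δ _
    rw [mul_inv_rev, mul_assoc, inv_mul_cancel_left]
  · obtain ⟨Φ, hΦ⟩ := Stability.Stab.exists_equiv hσ
    refine ⟨Φ, hΦ, fun x y => ?_⟩
    obtain ⟨g, rfl⟩ := Stability.Stab.Orbit.mk_surjective σ x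
    obtain ⟨h, rfl⟩ := Stability.Stab.Orbit.mk_surjective σ y
    rw [hΦ, hΦ]
    exact Stability.Stab.quotDist_act hσ g h
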